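/- All systems are finite dimensional; logarithms are to base 2. For states, $D_{\max}(\rho\|\sigma)=\inf\{\lambda\in\mathbb R:\rho\le 2^{\lambda}\sigma\}$, $D_{\min}(\rho\|\sigma)=-\log\operatorname{Tr}[\Pi_\rho\sigma]$, where $\Pi_\rho$ is the projector onto the support of $\rho$, and $F(\rho,\sigma)=\|\sqrt\rho\sqrt\sigma\|_1^2$ (the first two may be $+\infty$). Let $\mathbb O$ be any set of channels (the free channels), between arbitrary systems, which is closed under tensor products: $\mathcal M_1,\mathcal M_2\in\mathbb O\Rightarrow\mathcal M_1\otimes\mathcal M_2\in\mathbb O$. For a channel $\mathcal N$ put, for $\bullet\in\{\min,\max\}$, $$D_{\bullet,\mathbb O}(\mathcal N)=\inf_{\mathcal M\in\mathbb O}\ \sup_\psi D_\bullet\big(\mathrm{id}\otimes\mathcal N(\psi)\,\|\,\mathrm{id}\otimes\mathcal M(\psi)\big)\in[0,\infty],$$ where $\mathcal M$ has the same input and output systems as $\mathcal N$ and $\psi$ runs over the pure states of the input system with an arbitrary reference system. Let $F(\mathcal E_1,\mathcal E_2)=\min_\psi F(\mathrm{id}\otimes\mathcal E_1(\psi),\mathrm{id}\otimes\mathcal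 E_2(\psi))$ be the worst-case fidelity of channels. Let $\mathbb S$ be any set of superchannels (channel transformations realized by a pre-processing and a post-processing channel connected by a quantum memory) that map free channels to free channels; its elements are the free superchannels. **Theorem.** Let $\mathcal E$ be a channel, and let $\mathcal T$ be a channel such that $\mathrm{id}\otimes\mathcal T(\psi)$ is pure for every pure state $\psi$. Let $d,c\ge 0$, and suppose that for all $n\ge 1$ there are free superchannels $\Theta_n$ and $\Theta'_n$ with $$1-F\big(\Theta_n(\mathcal E^{\otimes n}),\mathcal T^{\otimes\lfloor dn\rfloor}\big)=\delta_n,\qquad 1-F\big(\Theta'_n(\mathcal T^{\otimes\lceil cn\rceil}),\mathcal E^{\otimes n}\big)=\varepsilon_n,\qquad \liminf_{n\to\infty}(\varepsilon_n+\delta_n)<1 .$$ If $c=0$, suppose also that the identity channel of the trivial system $\mathbb C$ is free. Then, with $0\cdot\infty=0$, $$d\cdot\liminf_{n\to\infty}\frac1n D_{\min,\mathbb O}(\mathcal T^{\otimes n})\ \le\ c\cdot\limsup_{n\to\infty}\frac1n D_{\max,\mathbb O}(\mathcal T^{\otimes n}).$$ When the regularized quantities $D^\infty_{\bullet,\mathbb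 O}(\mathcal T)=\lim_{n\to\infty}\frac1n D_{\bullet,\mathbb O}(\mathcal T^{\otimes n})$ exist, this is the inequality $d\cdot D^\infty_{\min,\mathbb O}(\mathcal T)\le c\cdot D^\infty_{\max,\mathbb O}(\mathcal T)$. Moreover, if $D_{\max,\mathbb O}(\mathcal T)<\infty$, then $D^\infty_{\max,\mathbb O}(\mathcal T)$ exists and is finite. If the input system of $\mathcal T$ is one-dimensional (as in resource theories of states) and $D_{\min,\mathbb O}(\mathcal T)<\infty$, then $D^\infty_{\min,\mathbb O}(\mathcal T)$ exists and is finite. -/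

import Mathlib

open Filter Topology
open scoped MatrixOrder ComplexOrder

noncomputable section

namespace QRT

/-! ### Operators, states, channels -/

/-- Operators on the Hilbert space `ℂ^ι`. -/
abbrev Op (ι : Type) : Type := Matrix ι ι ℂ

/-- Linear maps from operators on `ℂ^ι` to operators on `ℂ^κ`. -/
abbrev OpMap (ι κ : Type) : Type := Op ι →ₗ[ℂ] Op κ

/-- `id_R ⊗ Φ`, the map that acts as `Φ` on the second tensor factor. -/
def idTensor (R : Type) {ι κ : Type} (Φ : OpMap ι κ) : OpMap (R × ι) (R × κ) where
  toFun X := Matrix.of fun p q => Φ (Matrix.of fun a a' => X (p.1, a) (q.1, a')) p.2 q.2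
  map_add' X Y := by
    ext p q
    exact congrFun (congrFun (Φ.map_add (Matrix.of fun a a' => X (p.1, a) (q.1, a'))
      (Matrix.of fun a a' => Y (p.1, a) (q.1, a'))) p.2) q.2
  map_smul' z X := by
    ext p q
    exact congrFun (congrFun (Φ.map_smul z (Matrix.of fun a a' => X (p.1, a) (q.1, a'))) p.2) q.2

/-- `Φ ⊗ id_R`, the map that acts as `Φ` on the first tensor factor. -/
def tensorId (R : Type) {ι κ : Type} (Φ : OpMap ι κ) : OpMap (ι × R) (κ × R) where
  toFun X := Matrix.of fun p q => Φ (Matrix.of fun a a' => X (a, p.2) (a', q.2)) p.1 q.1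
  map_add' X Y := by
    ext p q
    exact congrFun (congrFun (Φ.map_add (Matrix.of fun a a' => X (a, p.2) (a', q.2))
      (Matrix.of fun a a' => Y (a, p.2) (a', q.2))) p.1) q.1
  map_smul' z X := by
    ext p q
    exact congrFun (congrFun (Φ.map_smul z (Matrix.of fun a a' => X (a, p.2) (a', q.2))) p.1) q.1

/-- The tensor product `Φ ⊗ Ψ = (id ⊗ Ψ) ∘ (Φ ⊗ id)` of two maps. -/
def tensorMap {ι κ ι' κ' : Type} (Φ : OpMap ι κ) (Ψ : OpMap ι' κ') :
    OpMap (ι × ι') (κ × κ') :=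
  idTensor κ Ψ ∘ₗ tensorId ι' Φ

/-- Completely positive: `id_k ⊗ Φ` preserves positive semidefiniteness for every `k`. -/
def IsCP {ι κ : Type} (Φ : OpMap ι κ) : Prop :=
  ∀ (k : ℕ) (X : Op (Fin k × ι)), X.PosSemidef → (idTensor (Fin k) Φ X).PosSemidef

/-- Quantum channels: completely positive trace-preserving maps. -/
def IsChannel {ι κ : Type} [Fintype ι] [Fintype κ] (Φ : OpMap ι κ) : Prop :=
  IsCP Φ ∧ ∀ X : Op ι, (Φ X).trace = X.trace

/-- `ρ = |v⟩⟨v|` for a unit vector `v`. -/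
def IsPureState {ι : Type} [Fintype ι] (ρ : Op ι) : Prop :=
  ∃ v : ι → ℂ, star v ⬝ᵥ v = 1 ∧ ρ = Matrix.vecMulVec v (star v)

/-- A pure state of `ℂ^k ⊗ ℂ^ι`, where the dimension `k` of the reference system is arbitrary. -/
structure PureInput (ι : Type) [Fintype ι] where
  /-- dimension of the reference system -/
  refDim : ℕ
  /-- density operator of the state -/
  state : Op (Fin refDim × ι)
  pure : IsPureState state

/-- The output state `id ⊗ Φ (ψ)`. -/
def outState {ι κ : Type} [Fintype ι] (Φ : OpMap ι κ) (ψ : PureInput ι) :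
    Op (Fin ψ.refDim × κ) :=
  idTensor (Fin ψ.refDim) Φ ψ.state

/-- `id ⊗ Φ (ψ)` is pure for every pure state `ψ`. -/
def IsPureChannel {ι κ : Type} [Fintype ι] [Fintype κ] (Φ : OpMap ι κ) : Prop :=
  ∀ ψ : PureInput ι, IsPureState (outState Φ ψ)

/-! ### Fidelity and divergences -/

/-- The trace norm `‖X‖₁ = Tr √(X† X)`. -/
def traceNorm {ι : Type} [Fintype ι] [DecidableEq ι] (X : Op ι) : ℝ :=
  (CFC.sqrt (X.conjTranspose * X)).trace.re

/-- The fidelity `F(ρ, σ) = ‖√ρ √σ‖₁²` of states. -/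
def fidelity {ι : Type} [Fintype ι] [DecidableEq ι] (ρ σ : Op ι) : ℝ :=
  traceNorm (CFC.sqrt ρ * CFC.sqrt σ) ^ 2

/-- The worst-case fidelity of channels, minimized over all pure inputs with a reference. -/
def chanFidelity {ι κ : Type} [Fintype ι] [Fintype κ] [DecidableEq κ] (Φ Ψ : OpMap ι κ) : ℝ :=
  ⨅ ψ : PureInput ι, fidelity (outState Φ ψ) (outState Ψ ψ)

/-- `D_max(ρ‖σ) = inf {l | ρ ≤ 2^l σ}`, which is `⊤` if there is no such `l`. -/
def stateDmax {ι : Type} [Fintype ι] (ρ σ : Op ι) : EReal :=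
  sInf {x : EReal | ∃ l : ℝ, x = (l : EReal) ∧ (((2 : ℝ) ^ l) • σ - ρ).PosSemidef}

/-- The orthogonal projector onto the support of `ρ`. -/
def supportProj {ι : Type} [Fintype ι] [DecidableEq ι] (ρ : Op ι) : Op ι :=
  cfc (fun x : ℝ => if x = 0 then (0 : ℝ) else 1) ρ

/-- `-log₂ x`, with the value `⊤` at `x = 0`. -/
def negLog2 (x : ℝ) : EReal :=
  if x ≤ 0 then ⊤ else ((-Real.logb 2 x : ℝ) : EReal)

/-- `D_min(ρ‖σ) = -log₂ Tr (Π_ρ σ)`. -/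
def stateDmin {ι : Type} [Fintype ι] [DecidableEq ι] (ρ σ : Op ι) : EReal :=
  negLog2 (supportProj ρ * σ).trace.re

/-- The channel divergence `sup_ψ D_max(id ⊗ Φ(ψ) ‖ id ⊗ Ψ(ψ))`. -/
def chanDmax {ι κ : Type} [Fintype ι] [Fintype κ] (Φ Ψ : OpMap ι κ) : EReal :=
  ⨆ ψ : PureInput ι, stateDmax (outState Φ ψ) (outState Ψ ψ)

/-- The channel divergence `sup_ψ D_min(id ⊗ Φ(ψ) ‖ id ⊗ Ψ(ψ))`. -/
def chanDmin {ι κ : Type} [Fintype ι] [Fintype κ] [DecidableEq κ] (Φ Ψ : OpMap ι κ) : EReal :=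
  ⨆ ψ : PureInput ι, stateDmin (outState Φ ψ) (outState Ψ ψ)

/-! ### Systems

Elementary systems carry labels in a type `L`; the label `a` stands for a system with Hilbert space
`ℂ^(dim a)`. Labels may hold more than the dimension, for example the party that owns the system.
A composite system is a list of labels, and the tensor product of systems is concatenation. -/

/-- The standard basis of the Hilbert space of a composite system. -/
def Idx {L : Type*} (dim : L → ℕ+) : List L → Type
  | [] => Unit
  | a :: s => Fin (dim a) × Idx dim s

instance Idx.instFintype {L : Type*} (dim : L → ℕ+) : (s : List L) → Fintype (Idx dim s)
  | [] => inferInstanceAs (Fintype Unit)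
  | a :: s =>
    letI := Idx.instFintype dim s
    inferInstanceAs (Fintype (Fin (dim a) × Idx dim s))

instance Idx.instDecidableEq {L : Type*} (dim : L → ℕ+) :
    (s : List L) → DecidableEq (Idx dim s)
  | [] => inferInstanceAs (DecidableEq Unit)
  | a :: s =>
    letI := Idx.instDecidableEq dim s
    inferInstanceAs (DecidableEq (Fin (dim a) × Idx dim s))

/-- The Hilbert space of `s ++ t` is the tensor product of those of `s` and `t`. -/
def Idx.appendEquiv {L : Type*} (dim : L → ℕ+) :
    (s t : List L) → Idx dim (s ++ t) ≃ Idx dim s × Idx dim t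
  | [], t => (Equiv.punitProd (Idx dim t)).symm
  | a :: s, t =>
    ((Equiv.refl (Fin (dim a))).prodCongr (Idx.appendEquiv dim s t)).trans
      (Equiv.prodAssoc (Fin (dim a)) (Idx dim s) (Idx dim t)).symm

/-- Linear maps from operators on the system `s` to operators on the system `t`. -/
abbrev SysMap {L : Type*} (dim : L → ℕ+) (s t : List L) : Type :=
  OpMap (Idx dim s) (Idx dim t)

/-- The tensor product of two maps between composite systems. -/
def sysTensor {L : Type*} {dim : L → ℕ+} {s t s' t' : List L}
    (Φ : SysMap dim s t) (Ψ : SysMap dim s' t') : SysMap dim (s ++ s') (t ++ t') :=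
  (Matrix.reindexLinearEquiv ℂ ℂ (Idx.appendEquiv dim t t').symm
      (Idx.appendEquiv dim t t').symm).toLinearMap ∘ₗ
    tensorMap Φ Ψ ∘ₗ
    (Matrix.reindexLinearEquiv ℂ ℂ (Idx.appendEquiv dim s s')
      (Idx.appendEquiv dim s s')).toLinearMap

/-- `n` copies of the system `s`. -/
def sysPow {L : Type*} (s : List L) : ℕ → List L
  | 0 => []
  | n + 1 => s ++ sysPow s n

/-- The tensor power `Φ^{⊗ n}`; for `n = 0` it is the identity of the trivial system `ℂ`. -/
def mapPow {L : Type*} {dim : L → ℕ+} {s t : List L} (Φ : SysMap dim s t) :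
    (n : ℕ) → SysMap dim (sysPow s n) (sysPow t n)
  | 0 => LinearMap.id (R := ℂ) (M := Op (Idx dim ([] : List L)))
  | n + 1 => sysTensor Φ (mapPow Φ n)

/-! ### Superchannels and resource measures -/

/-- A superchannel: `N ↦ Post ∘ (id ⊗ N) ∘ Pre` with channels `Pre` and `Post`, which are connected
by a quantum memory of finite dimension `m`. -/
def IsSuperchannel {ι κ ι' κ' : Type} [Fintype ι] [Fintype κ] [Fintype ι'] [Fintype κ']
    (Θ : OpMap ι κ →ₗ[ℂ] OpMap ι' κ') : Prop :=
  ∃ (m : ℕ) (Pre : OpMap ι' (Fin m × ι)) (Post : OpMap (Fin m × κ) κ'),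
    IsChannel Pre ∧ IsChannel Post ∧ ∀ N : OpMap ι κ, Θ N = Post ∘ₗ idTensor (Fin m) N ∘ₗ Pre

/-- For every pair of systems a set of maps, meant to be the free channels. -/
abbrev MapFamily {L : Type*} (dim : L → ℕ+) : Type _ :=
  ∀ s t : List L, Set (SysMap dim s t)

/-- For all pairs of systems a set of maps between maps, meant to be the free superchannels. -/
abbrev SuperFamily {L : Type*} (dim : L → ℕ+) : Type _ :=
  ∀ s t s' t' : List L, Set (SysMap dim s t →ₗ[ℂ] SysMap dim s' t')

/-- `D_{max,O}(Φ)`: infimum over the free channels with the same input and output systems. -/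
def Dmax {L : Type*} {dim : L → ℕ+} (O : MapFamily dim) {s t : List L}
    (Φ : SysMap dim s t) : EReal :=
  ⨅ M ∈ O s t, chanDmax Φ M

/-- `D_{min,O}(Φ)`: infimum over the free channels with the same input and output systems. -/
def Dmin {L : Type*} {dim : L → ℕ+} (O : MapFamily dim) {s t : List L}
    (Φ : SysMap dim s t) : EReal :=
  ⨅ M ∈ O s t, chanDmin Φ M

/-- The sequence `D_{max,O}(Φ^{⊗ n}) / n`. -/
def DmaxRate {L : Type*} {dim : L → ℕ+} (O : MapFamily dim) {s t : List L}
    (Φ : SysMap dim s t) (n : ℕ) : EReal :=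
  Dmax O (mapPow Φ n) / (n : EReal)

/-- The sequence `D_{min,O}(Φ^{⊗ n}) / n`. -/
def DminRate {L : Type*} {dim : L → ℕ+} (O : MapFamily dim) {s t : List L}
    (Φ : SysMap dim s t) (n : ℕ) : EReal :=
  Dmin O (mapPow Φ n) / (n : EReal)

end QRT

end

open QRT

namespace QRT

/-! ### Positive operators and partial traces -/

/-! Dilution followed by distillation sends `⌈c * n⌉₊` copies of `T` to an approximation of `⌊d *
n⌋₊` copies, and free superchannels cannot create resource. If `2 ^ l • M` dominates the input power
of `T` in the CP order with `M` free, this order survives both superchannels, and the image `M'` of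
`M` is still free. Test it on the pure output `τ` of the target power at an input `ψ`: the overlap
of `τ` with the output of `M'` is at least `2 ^ (-l)` times its overlap `p` with the output of the
composite protocol. So a lower bound on `p`, uniform in `ψ` and `n`, bounds the min-measure of the
target by the max-measure of the source plus a constant, which vanishes after division by `n`.

The lower bound comes from one measurement inequality, `sqrt_fidelity_le_of_isEffect`: `√F(ρ, σ) ≤
√f(ρ) + √(1 - f(σ))` for every effect `f`. Applied to the whole stage after dilution, ending in the
test `τ`, it gives `√F₁ ≤ √p + √(1 - F₂)`, where `F₁`, `F₂` are the fidelities of dilution and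
distillation. If `F₁ + F₂ ≥ 1 + η`, then `p ≥ η ^ 2 / 4`; this is why the errors need only sum to
less than 1. The one-shot statement is `chanDmin_le_of_superchannels`, and the passage to rates is
`mul_liminf_le_mul_limsup`.

The limits exist by Fekete's lemma. Tensor products of free channels are free, so the max-measure is
subadditive. For a one-dimensional input the min-divergence does not depend on `ψ` and overlaps
factorize, so the min-measure is subadditive too. -/

theorem posSemidef_iff_exists_mul_conjTranspose {ι : Type} [Fintype ι] {X : Op ι} :
    X.PosSemidef ↔ ∃ B : Op ι, X = B * B.conjTranspose := by
  classical
  constructor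
  · intro h
    obtain ⟨B, hB⟩ := CStarAlgebra.nonneg_iff_eq_star_mul_self.mp h.nonneg
    exact ⟨star B, by rw [hB, ← Matrix.star_eq_conjTranspose, star_star]⟩
  · rintro ⟨B, rfl⟩
    exact Matrix.posSemidef_self_mul_conjTranspose B

/-- The partial trace over the first tensor factor. -/
def ptrace (J : Type) [Fintype J] (ι : Type) : Op (J × ι) →ₗ[ℂ] Op ι where
  toFun X := Matrix.of fun a b => ∑ j, X (j, a) (j, b)
  map_add' X Y := by ext; simp [Finset.sum_add_distrib]
  map_smul' z X := by ext; simp [Finset.mul_sum]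

theorem ptrace_eq_sum {J ι : Type} [Fintype J] (X : Op (J × ι)) :
    ptrace J ι X = ∑ j, X.submatrix (fun a => (j, a)) (fun a => (j, a)) := by
  ext a b
  simp [ptrace, Matrix.sum_apply]

theorem ptrace_posSemidef {J ι : Type} [Fintype J] {X : Op (J × ι)} (h : X.PosSemidef) :
    (ptrace J ι X).PosSemidef := by
  rw [ptrace_eq_sum]
  exact Matrix.posSemidef_sum _ fun j _ => h.submatrix _

theorem trace_ptrace {J ι : Type} [Fintype J] [Fintype ι] (X : Op (J × ι)) :
    (ptrace J ι X).trace = X.trace := by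
  simp only [Matrix.trace, ptrace, Matrix.diag, LinearMap.coe_mk, AddHom.coe_mk, Matrix.of_apply]
  rw [Finset.sum_comm, Fintype.sum_prod_type]

/-- Purification: for `X = B * B†`, the entries of `B` read as a vector on two copies of the system.
-/
theorem exists_ptrace_vecMulVec {ι : Type} [Fintype ι] {X : Op ι} (h : X.PosSemidef) :
    ∃ w : ι × ι → ℂ, X = ptrace ι ι (Matrix.vecMulVec w (star w)) := by
  obtain ⟨B, rfl⟩ := posSemidef_iff_exists_mul_conjTranspose.mp h
  refine ⟨fun p => B p.2 p.1, ?_⟩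
  ext a b
  simp [ptrace, Matrix.mul_apply, Matrix.vecMulVec_apply]

theorem trace_vecMulVec_star {ι : Type} [Fintype ι] (w : ι → ℂ) :
    (Matrix.vecMulVec w (star w)).trace = star w ⬝ᵥ w := by
  rw [Matrix.trace_vecMulVec, dotProduct_comm]

theorem IsPureState.posSemidef {ι : Type} [Fintype ι] {ρ : Op ι} (h : IsPureState ρ) :
    ρ.PosSemidef := by
  obtain ⟨v, -, rfl⟩ := h
  exact Matrix.posSemidef_vecMulVec_self_star v

theorem IsPureState.trace_eq_one {ι : Type} [Fintype ι] {ρ : Op ι} (h : IsPureState ρ) :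
    ρ.trace = 1 := by
  obtain ⟨v, hv, rfl⟩ := h
  rw [trace_vecMulVec_star, hv]

theorem IsPureState.mul_self {ι : Type} [Fintype ι] {ρ : Op ι} (h : IsPureState ρ) :
    ρ * ρ = ρ := by
  obtain ⟨v, hv, rfl⟩ := h
  rw [Matrix.vecMulVec_mul_vecMulVec, hv]
  simp

theorem IsPureState.submatrix {ι κ : Type} [Fintype ι] [Fintype κ] {ρ : Op ι}
    (h : IsPureState ρ) (e : κ ≃ ι) : IsPureState (ρ.submatrix e e) := by
  obtain ⟨v, hv, rfl⟩ := h
  refine ⟨v ∘ e, ?_, ?_⟩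
  · rw [← hv]
    exact Equiv.sum_comp e fun i => star (v i) * v i
  · ext a b
    simp [Matrix.vecMulVec_apply]

theorem exists_pure_ptrace {ι : Type} [Fintype ι] {X : Op ι} (h : X.PosSemidef)
    (htr : X.trace = 1) : ∃ ρ : Op (ι × ι), IsPureState ρ ∧ X = ptrace ι ι ρ := by
  obtain ⟨w, rfl⟩ := exists_ptrace_vecMulVec h
  refine ⟨_, ⟨w, ?_, rfl⟩, rfl⟩
  rw [← trace_vecMulVec_star, ← trace_ptrace, htr]

/-! ### Ancillary systems -/

theorem idTensor_apply {R ι κ : Type} (Φ : OpMap ι κ) (X : Op (R × ι)) (p q : R × κ) :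
    idTensor R Φ X p q = Φ (Matrix.of fun a a' => X (p.1, a) (q.1, a')) p.2 q.2 := rfl

theorem idTensor_submatrix {R R' ι κ : Type} (e : R → R') (Φ : OpMap ι κ) (X : Op (R' × ι)) :
    idTensor R Φ (X.submatrix (Prod.map e id) (Prod.map e id)) =
      (idTensor R' Φ X).submatrix (Prod.map e id) (Prod.map e id) := rfl

theorem idTensor_idTensor {R R' ι κ : Type} (Φ : OpMap ι κ) (X : Op (R × R' × ι)) :
    idTensor R (idTensor R' Φ) X =
      (idTensor (R × R') Φ
        (X.submatrix (Equiv.prodAssoc R R' ι) (Equiv.prodAssoc R R' ι))).submatrix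
        (Equiv.prodAssoc R R' κ).symm (Equiv.prodAssoc R R' κ).symm := rfl

/-- The exchange of the last two of three tensor factors. -/
def swapLast (R ι R' : Type) : (R × R') × ι ≃ R × ι × R' :=
  (Equiv.prodAssoc R R' ι).trans ((Equiv.refl R).prodCongr (Equiv.prodComm R' ι))

theorem idTensor_tensorId {R R' ι κ : Type} (Φ : OpMap ι κ) (X : Op (R × ι × R')) :
    idTensor R (tensorId R' Φ) X =
      (idTensor (R × R') Φ (X.submatrix (swapLast R ι R') (swapLast R ι R'))).submatrix
        (swapLast R κ R').symm (swapLast R κ R').symm := rfl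

theorem idTensor_ptrace {J R ι κ : Type} [Fintype J] (Φ : OpMap ι κ) (X : Op (J × R × ι)) :
    idTensor R Φ (ptrace J (R × ι) X) = ptrace J (R × κ) (idTensor J (idTensor R Φ) X) := by
  ext p q
  have h : (Matrix.of fun a a' => ptrace J (R × ι) X (p.1, a) (q.1, a')) =
      ∑ j, Matrix.of fun a a' => X (j, p.1, a) (j, q.1, a') := by
    ext a b
    simp [ptrace, Matrix.sum_apply]
  rw [idTensor_apply, h, map_sum, Matrix.sum_apply]
  rfl

theorem IsCP.posSemidef {ι κ R : Type} [Fintype R] {Φ : OpMap ι κ} (h : IsCP Φ)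
    {X : Op (R × ι)} (hX : X.PosSemidef) : (idTensor R Φ X).PosSemidef := by
  have e := Fintype.equivFin R
  have := (h _ _ (hX.submatrix (Prod.map e.symm id))).submatrix (Prod.map e id)
  rw [idTensor_submatrix, Matrix.submatrix_submatrix, Prod.map_comp_map] at this
  simpa using this

theorem IsCP.apply_posSemidef {ι κ : Type} {Φ : OpMap ι κ} (h : IsCP Φ)
    {X : Op ι} (hX : X.PosSemidef) : (Φ X).PosSemidef :=
  (h.posSemidef (R := Unit) (hX.submatrix Prod.snd)).submatrix (fun a => ((), a))

theorem IsCP.comp {ι κ μ : Type} {Ψ : OpMap κ μ} {Φ : OpMap ι κ} (hΨ : IsCP Ψ) (hΦ : IsCP Φ) :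
    IsCP (Ψ ∘ₗ Φ) := fun k X hX => hΨ k _ (hΦ k X hX)

theorem IsCP.idTensor {R ι κ : Type} [Fintype R] {Φ : OpMap ι κ} (h : IsCP Φ) :
    IsCP (idTensor R Φ) := by
  intro k X hX
  rw [idTensor_idTensor]
  exact (h.posSemidef (hX.submatrix _)).submatrix _

theorem IsCP.tensorId {R ι κ : Type} [Fintype R] {Φ : OpMap ι κ} (h : IsCP Φ) :
    IsCP (tensorId R Φ) := by
  intro k X hX
  rw [idTensor_tensorId]
  exact (h.posSemidef (hX.submatrix _)).submatrix _

theorem IsCP.tensorMap {ι κ ι' κ' : Type} [Fintype κ] [Fintype ι'] {Φ : OpMap ι κ}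
    {Ψ : OpMap ι' κ'} (hΦ : IsCP Φ) (hΨ : IsCP Ψ) : IsCP (tensorMap Φ Ψ) :=
  hΨ.idTensor.comp hΦ.tensorId

theorem IsCP.add {ι κ : Type} {Φ Ψ : OpMap ι κ} (hΦ : IsCP Φ) (hΨ : IsCP Ψ) : IsCP (Φ + Ψ) :=
  fun k X hX => (hΦ k X hX).add (hΨ k X hX)

theorem IsCP.smul {ι κ : Type} {Φ : OpMap ι κ} (hΦ : IsCP Φ) {z : ℝ} (hz : 0 ≤ z) :
    IsCP (z • Φ) :=
  fun k X hX => (hΦ k X hX).smul hz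

theorem isCP_reindex {ι κ : Type} (e : ι ≃ κ) :
    IsCP (Matrix.reindexLinearEquiv ℂ ℂ e e).toLinearMap :=
  fun _ _ hX => hX.submatrix (Prod.map id e.symm)

/-- The divergences only see pure inputs. A nonzero positive input is a multiple of a state; purify
it, enlarging the reference, and trace out the purifying system after the map has acted. -/
theorem isCP_of_pureInput {ι κ : Type} [Fintype ι] {Φ : OpMap ι κ}
    (h : ∀ ψ : PureInput ι, (outState Φ ψ).PosSemidef) : IsCP Φ := by
  have hpure {R : Type} [Fintype R] {ρ : Op (R × ι)} (hρ : IsPureState ρ) :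
      (idTensor R Φ ρ).PosSemidef := by
    have e := Fintype.equivFin R
    have := (h ⟨_, _, hρ.submatrix (e.symm.prodCongr (Equiv.refl ι))⟩).submatrix (Prod.map e id)
    rw [outState] at this
    have h2 : idTensor (Fin (Fintype.card R)) Φ (ρ.submatrix (e.symm.prodCongr (Equiv.refl ι))
      (e.symm.prodCongr (Equiv.refl ι))) = (idTensor R Φ ρ).submatrix (Prod.map e.symm id)
        (Prod.map e.symm id) := rfl
    rw [h2, Matrix.submatrix_submatrix, Prod.map_comp_map] at this
    simpa using this
  intro k X hX
  by_cases htr : X.trace = 0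
  · rw [hX.trace_eq_zero_iff.mp htr, map_zero]
    exact Matrix.PosSemidef.zero
  have hpos : 0 < X.trace := lt_of_le_of_ne hX.trace_nonneg (Ne.symm htr)
  have h0 : (0 : ℂ) ≤ X.trace⁻¹ := (RCLike.inv_pos_of_pos hpos).le
  obtain ⟨ρ, hρ, hXρ⟩ := exists_pure_ptrace (hX.smul h0) (by simp [htr])
  have hX' : X = X.trace • ptrace _ _ ρ := by
    rw [← hXρ, smul_smul, mul_inv_cancel₀ htr, one_smul]
  rw [hX', map_smul]
  refine Matrix.PosSemidef.smul ?_ hpos.le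
  rw [idTensor_ptrace, idTensor_idTensor]
  exact ptrace_posSemidef ((hpure (hρ.submatrix _)).submatrix _)

/-! ### Channels -/

theorem trace_idTensor {R ι κ : Type} [Fintype R] [Fintype ι] [Fintype κ] {Φ : OpMap ι κ}
    (h : ∀ X : Op ι, (Φ X).trace = X.trace) (X : Op (R × ι)) :
    (idTensor R Φ X).trace = X.trace := by
  simp only [Matrix.trace, Matrix.diag, Fintype.sum_prod_type] at h ⊢
  exact Finset.sum_congr rfl fun r _ => h (Matrix.of fun a a' => X (r, a) (r, a'))

theorem trace_tensorId {R ι κ : Type} [Fintype R] [Fintype ι] [Fintype κ] {Φ : OpMap ι κ}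
    (h : ∀ X : Op ι, (Φ X).trace = X.trace) (X : Op (ι × R)) :
    (tensorId R Φ X).trace = X.trace := by
  simp only [Matrix.trace, Matrix.diag, Fintype.sum_prod_type_right] at h ⊢
  exact Finset.sum_congr rfl fun r _ => h (Matrix.of fun a a' => X (a, r) (a', r))

theorem trace_submatrix_equiv {ι κ : Type} [Fintype ι] [Fintype κ] (e : ι ≃ κ) (X : Op κ) :
    (X.submatrix e e).trace = X.trace :=
  Equiv.sum_comp e fun i => X i i

theorem IsChannel.comp {ι κ μ : Type} [Fintype ι] [Fintype κ] [Fintype μ] {Ψ : OpMap κ μ}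
    {Φ : OpMap ι κ} (hΨ : IsChannel Ψ) (hΦ : IsChannel Φ) : IsChannel (Ψ ∘ₗ Φ) :=
  ⟨hΨ.1.comp hΦ.1, fun X => (hΨ.2 _).trans (hΦ.2 X)⟩

theorem IsChannel.idTensor {R ι κ : Type} [Fintype R] [Fintype ι] [Fintype κ] {Φ : OpMap ι κ}
    (h : IsChannel Φ) : IsChannel (idTensor R Φ) :=
  ⟨h.1.idTensor, trace_idTensor h.2⟩

theorem IsChannel.tensorId {R ι κ : Type} [Fintype R] [Fintype ι] [Fintype κ] {Φ : OpMap ι κ}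
    (h : IsChannel Φ) : IsChannel (tensorId R Φ) :=
  ⟨h.1.tensorId, trace_tensorId h.2⟩

theorem isChannel_reindex {ι κ : Type} [Fintype ι] [Fintype κ] (e : ι ≃ κ) :
    IsChannel (Matrix.reindexLinearEquiv ℂ ℂ e e).toLinearMap :=
  ⟨isCP_reindex e, fun X => trace_submatrix_equiv e.symm X⟩

theorem IsSuperchannel.isCP {ι κ ι' κ' : Type} [Fintype ι] [Fintype κ] [Fintype ι'] [Fintype κ']
    {Θ : OpMap ι κ →ₗ[ℂ] OpMap ι' κ'} (hΘ : IsSuperchannel Θ) {Φ : OpMap ι κ} (hΦ : IsCP Φ) :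
    IsCP (Θ Φ) := by
  obtain ⟨m, Pre, Post, hPre, hPost, h⟩ := hΘ
  rw [h]
  exact hPost.1.comp (hΦ.idTensor.comp hPre.1)

theorem IsSuperchannel.isChannel {ι κ ι' κ' : Type} [Fintype ι] [Fintype κ] [Fintype ι']
    [Fintype κ'] {Θ : OpMap ι κ →ₗ[ℂ] OpMap ι' κ'} (hΘ : IsSuperchannel Θ) {Φ : OpMap ι κ}
    (hΦ : IsChannel Φ) : IsChannel (Θ Φ) := by
  obtain ⟨m, Pre, Post, hPre, hPost, h⟩ := hΘ
  rw [h]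
  exact hPost.comp (hΦ.idTensor.comp hPre)

theorem outState_posSemidef {ι κ : Type} [Fintype ι] {Φ : OpMap ι κ} (h : IsCP Φ)
    (ψ : PureInput ι) : (outState Φ ψ).PosSemidef :=
  h _ _ ψ.pure.posSemidef

theorem trace_outState {ι κ : Type} [Fintype ι] [Fintype κ] {Φ : OpMap ι κ} (h : IsChannel Φ)
    (ψ : PureInput ι) : (outState Φ ψ).trace = 1 := by
  rw [outState, trace_idTensor h.2, ψ.pure.trace_eq_one]

/-! ### Pure channels -/

theorem IsPureChannel.isPureState {ι κ R : Type} [Fintype ι] [Fintype κ] [Fintype R]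
    {Φ : OpMap ι κ} (h : IsPureChannel Φ) {ρ : Op (R × ι)} (hρ : IsPureState ρ) :
    IsPureState (idTensor R Φ ρ) := by
  have e := Fintype.equivFin R
  have := (h ⟨_, _, hρ.submatrix (e.symm.prodCongr (Equiv.refl ι))⟩).submatrix
    (e.prodCongr (Equiv.refl κ))
  rw [outState] at this
  have h2 : idTensor (Fin (Fintype.card R)) Φ (ρ.submatrix (e.symm.prodCongr (Equiv.refl ι))
    (e.symm.prodCongr (Equiv.refl ι))) = (idTensor R Φ ρ).submatrix
      (e.symm.prodCongr (Equiv.refl κ)) (e.symm.prodCongr (Equiv.refl κ)) := rfl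
  rw [h2, Matrix.submatrix_submatrix] at this
  convert this
  ext ⟨a, a'⟩ ⟨b, b'⟩
  simp

theorem IsPureChannel.comp {ι κ μ : Type} [Fintype ι] [Fintype κ] [Fintype μ] {Ψ : OpMap κ μ}
    {Φ : OpMap ι κ} (hΨ : IsPureChannel Ψ) (hΦ : IsPureChannel Φ) : IsPureChannel (Ψ ∘ₗ Φ) :=
  fun ψ => hΨ.isPureState (hΦ.isPureState ψ.pure)

theorem IsPureChannel.idTensor {R ι κ : Type} [Fintype R] [Fintype ι] [Fintype κ]
    {Φ : OpMap ι κ} (h : IsPureChannel Φ) : IsPureChannel (idTensor R Φ) := by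
  intro ψ
  rw [outState, idTensor_idTensor]
  exact (h.isPureState (ψ.pure.submatrix _)).submatrix _

theorem IsPureChannel.tensorId {R ι κ : Type} [Fintype R] [Fintype ι] [Fintype κ]
    {Φ : OpMap ι κ} (h : IsPureChannel Φ) : IsPureChannel (tensorId R Φ) := by
  intro ψ
  rw [outState, idTensor_tensorId]
  exact (h.isPureState (ψ.pure.submatrix _)).submatrix _

theorem isPureChannel_reindex {ι κ : Type} [Fintype ι] [Fintype κ] (e : ι ≃ κ) :
    IsPureChannel (Matrix.reindexLinearEquiv ℂ ℂ e e).toLinearMap :=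
  fun ψ => ψ.pure.submatrix ((Equiv.refl _).prodCongr e.symm)

/-! ### Tensor products of maps between composite systems -/

section
variable {L : Type*} {dim : L → ℕ+} {s t s' t' : List L}

theorem IsCP.sysTensor {Φ : SysMap dim s t} {Ψ : SysMap dim s' t'} (hΦ : IsCP Φ)
    (hΨ : IsCP Ψ) : IsCP (sysTensor Φ Ψ) :=
  (isCP_reindex _).comp ((hΦ.tensorMap hΨ).comp (isCP_reindex _))

theorem IsChannel.sysTensor {Φ : SysMap dim s t} {Ψ : SysMap dim s' t'} (hΦ : IsChannel Φ)
    (hΨ : IsChannel Ψ) : IsChannel (sysTensor Φ Ψ) :=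
  (isChannel_reindex _).comp ((hΨ.idTensor.comp hΦ.tensorId).comp (isChannel_reindex _))

theorem IsPureChannel.sysTensor {Φ : SysMap dim s t} {Ψ : SysMap dim s' t'}
    (hΦ : IsPureChannel Φ) (hΨ : IsPureChannel Ψ) : IsPureChannel (sysTensor Φ Ψ) :=
  (isPureChannel_reindex _).comp ((hΨ.idTensor.comp hΦ.tensorId).comp (isPureChannel_reindex _))

theorem IsChannel.mapPow {Φ : SysMap dim s t} (h : IsChannel Φ) : ∀ n, IsChannel (mapPow Φ n)
  | 0 => ⟨fun _ _ hX => hX, fun _ => rfl⟩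
  | n + 1 => h.sysTensor (h.mapPow n)

theorem IsPureChannel.mapPow {Φ : SysMap dim s t} (h : IsPureChannel Φ) :
    ∀ n, IsPureChannel (mapPow Φ n)
  | 0 => fun ψ => ψ.pure
  | n + 1 => h.sysTensor (h.mapPow n)

theorem sysTensor_apply (Φ : SysMap dim s t) (Ψ : SysMap dim s' t') (X : Op (Idx dim (s ++ s')))
    (p q : Idx dim (t ++ t')) :
    sysTensor Φ Ψ X p q =
      Ψ (Matrix.of fun y y' => Φ (Matrix.of fun x x' =>
          X ((Idx.appendEquiv dim s s').symm (x, y)) ((Idx.appendEquiv dim s s').symm (x', y')))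
        (Idx.appendEquiv dim t t' p).1 (Idx.appendEquiv dim t t' q).1)
        (Idx.appendEquiv dim t t' p).2 (Idx.appendEquiv dim t t' q).2 := rfl

theorem sysTensor_sub_left (Φ Φ' : SysMap dim s t) (Ψ : SysMap dim s' t') :
    sysTensor (Φ - Φ') Ψ = sysTensor Φ Ψ - sysTensor Φ' Ψ := by
  ext1 X
  ext p q
  rw [LinearMap.sub_apply, Matrix.sub_apply, sysTensor_apply, sysTensor_apply, sysTensor_apply,
    ← Matrix.sub_apply, ← map_sub]
  rfl

theorem sysTensor_sub_right (Φ : SysMap dim s t) (Ψ Ψ' : SysMap dim s' t') :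
    sysTensor Φ (Ψ - Ψ') = sysTensor Φ Ψ - sysTensor Φ Ψ' := rfl

theorem sysTensor_smul_left (z : ℝ) (Φ : SysMap dim s t) (Ψ : SysMap dim s' t') :
    sysTensor (z • Φ) Ψ = z • sysTensor Φ Ψ := by
  ext1 X
  ext p q
  rw [LinearMap.smul_apply, Matrix.smul_apply, sysTensor_apply, sysTensor_apply,
    ← Matrix.smul_apply, ← LinearMap.map_smul_of_tower]
  rfl

theorem sysTensor_smul_right (z : ℝ) (Φ : SysMap dim s t) (Ψ : SysMap dim s' t') :
    sysTensor Φ (z • Ψ) = z • sysTensor Φ Ψ := rfl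

/-! ### Associativity -/

/-- The identification of the bases of equal systems. -/
def idxCast (dim : L → ℕ+) (h : s = t) : Idx dim s ≃ Idx dim t :=
  Equiv.cast (congrArg (Idx dim) h)

theorem idxCast_cons (a : L) (h : a :: s = a :: t) (x : Idx dim (a :: s)) :
    idxCast dim h x = (x.1, idxCast dim (List.cons.inj h).2 x.2) := by
  obtain rfl := (List.cons.inj h).2
  rfl

theorem appendEquiv_assoc (s t r : List L) (x : Idx dim (s ++ t ++ r)) :
    Idx.appendEquiv dim s (t ++ r) (idxCast dim (List.append_assoc s t r) x) =
      ((Idx.appendEquiv dim s t (Idx.appendEquiv dim (s ++ t) r x).1).1,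
        (Idx.appendEquiv dim t r).symm
          ((Idx.appendEquiv dim s t (Idx.appendEquiv dim (s ++ t) r x).1).2,
            (Idx.appendEquiv dim (s ++ t) r x).2)) := by
  induction s with
  | nil => exact Prod.ext rfl ((Idx.appendEquiv dim t r).symm_apply_apply x).symm
  | cons a s ih =>
    have h := ih x.2
    rw [idxCast_cons a (List.append_assoc (a :: s) t r)]
    refine Prod.ext (Prod.ext rfl ?_) ?_
    · exact (congrArg Prod.fst h :)
    · exact (congrArg Prod.snd h :)

/-- Regrouped tensor products live on lists that are only propositionally equal; this reduces their
`HEq` to an identity of matrix entries. -/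
theorem heq_of_submatrix_idxCast {Φ : SysMap dim s t} {Ψ : SysMap dim s' t'} (hs : s = s')
    (ht : t = t') (h : ∀ X p q, Φ (X.submatrix (idxCast dim hs) (idxCast dim hs)) p q =
      Ψ X (idxCast dim ht p) (idxCast dim ht q)) : HEq Φ Ψ := by
  subst hs ht
  refine heq_of_eq ?_
  ext1 X
  ext p q
  exact h X p q

theorem sysTensor_assoc {r r' : List L} (Φ : SysMap dim s s') (Ψ : SysMap dim t t')
    (Ξ : SysMap dim r r') :
    HEq (sysTensor (sysTensor Φ Ψ) Ξ) (sysTensor Φ (sysTensor Ψ Ξ)) := by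
  refine heq_of_submatrix_idxCast (List.append_assoc s t r) (List.append_assoc s' t' r') ?_
  intro X p q
  have key : ∀ x y z, idxCast dim (List.append_assoc s t r) ((Idx.appendEquiv dim (s ++ t) r).symm
      ((Idx.appendEquiv dim s t).symm (x, y), z)) = (Idx.appendEquiv dim s (t ++ r)).symm
        (x, (Idx.appendEquiv dim t r).symm (y, z)) := by
    intro x y z
    rw [Equiv.eq_symm_apply, appendEquiv_assoc]
    simp
  simp only [sysTensor_apply, appendEquiv_assoc, Equiv.apply_symm_apply, Matrix.submatrix_apply,
    Matrix.of_apply, key]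

theorem appendEquiv_nil (x : Idx dim s) :
    Idx.appendEquiv dim s [] (idxCast dim (List.append_nil s).symm x) = (x, ()) := by
  induction s with
  | nil => rfl
  | cons a s ih =>
    have h := ih x.2
    rw [idxCast_cons a (List.append_nil (a :: s)).symm]
    exact Prod.ext (Prod.ext rfl (congrArg Prod.fst h :)) rfl

theorem sysTensor_id_nil (Φ : SysMap dim s t) :
    HEq Φ (sysTensor Φ (LinearMap.id : SysMap dim [] [])) := by
  refine heq_of_submatrix_idxCast (List.append_nil s).symm (List.append_nil t).symm
    fun X p q => ?_
  have key (x : Idx dim s) : (Idx.appendEquiv dim s []).symm (x, ()) =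
      idxCast dim (List.append_nil s).symm x :=
    (Equiv.symm_apply_eq _).mpr (appendEquiv_nil x).symm
  rw [sysTensor_apply, appendEquiv_nil, appendEquiv_nil]
  change _ = Φ (Matrix.of fun x x' => X ((Idx.appendEquiv dim s []).symm (x, ()))
    ((Idx.appendEquiv dim s []).symm (x', ()))) p q
  simp only [key]
  rfl

theorem sysPow_add (s : List L) (m n : ℕ) : sysPow s (m + n) = sysPow s m ++ sysPow s n := by
  induction m with
  | zero => simp [sysPow]
  | succ m ih => rw [Nat.succ_add, sysPow, ih, sysPow, List.append_assoc]

theorem sysTensor_heq {a b a' b' : List L} {Φ : SysMap dim s t} {Ψ : SysMap dim a b}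
    {Ψ' : SysMap dim a' b'} (ha : a = a') (hb : b = b') (h : HEq Ψ Ψ') :
    HEq (sysTensor Φ Ψ) (sysTensor Φ Ψ') := by
  subst ha hb
  rw [eq_of_heq h]

theorem mapPow_one (Φ : SysMap dim s t) : HEq Φ (mapPow Φ 1) := sysTensor_id_nil Φ

theorem mapPow_add (Φ : SysMap dim s t) (m n : ℕ) :
    HEq (mapPow Φ (m + n)) (sysTensor (mapPow Φ m) (mapPow Φ n)) := by
  induction m with
  | zero => rw [Nat.zero_add]; rfl
  | succ m ih =>
    rw [Nat.succ_add]
    exact (sysTensor_heq (sysPow_add s m n) (sysPow_add t m n) ih).trans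
      (sysTensor_assoc Φ (mapPow Φ m) (mapPow Φ n)).symm

end

/-! ### Fidelity and measurements -/

section
variable {ι : Type} [Fintype ι] [DecidableEq ι]

theorem sqrt_eq_cfc_real {H : Op ι} (h : 0 ≤ H) : CFC.sqrt H = cfc Real.sqrt H := by
  rw [CFC.sqrt_eq_real_sqrt H h]
  exact cfcₙ_eq_cfc (a := H)

/-- Polar decomposition: `W = X |X|⁻¹`, with the inverse taken on the support of `|X|`. -/
theorem exists_contraction_traceNorm (X : Op ι) : ∃ W : Op ι, (1 - W.conjTranspose * W).PosSemidef ∧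
    (W.conjTranspose * X).trace.re = traceNorm X := by
  set H : Op ι := X.conjTranspose * X with hH
  have hpsd : H.PosSemidef := Matrix.posSemidef_conjTranspose_mul_self X
  have hsa : IsSelfAdjoint H := hpsd.isHermitian
  have hcont (g : ℝ → ℝ) : ContinuousOn g (spectrum ℝ H) :=
    Matrix.finite_real_spectrum.continuousOn g
  -- The convention `0⁻¹ = 0` makes `G` the pseudo-inverse of `|X|`, so no invertibility is needed.
  set G : Op ι := cfc (fun t : ℝ => (√t)⁻¹) H with hG
  have hGsa : G.conjTranspose = G := IsSelfAdjoint.cfc (f := fun t : ℝ => (√t)⁻¹) (a := H)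
  have hnn : ∀ t ∈ spectrum ℝ H, 0 ≤ t := fun t ht => spectrum_nonneg_of_nonneg hpsd.nonneg ht
  have hGH : G * H = cfc Real.sqrt H := by
    conv_lhs => rw [← cfc_id ℝ H hsa]
    rw [hG, cfc_id ℝ H hsa]
    conv_lhs => enter [2]; rw [← cfc_id ℝ H hsa]
    rw [← cfc_mul _ _ H (hcont _) (hcont _)]
    refine cfc_congr fun t ht => ?_
    change (√t)⁻¹ * t = √t
    rw [inv_mul_eq_div, Real.div_sqrt]
  refine ⟨X * G, ?_, ?_⟩
  · have h1 : (X * G).conjTranspose * (X * G) = cfc (fun t : ℝ => √t * (√t)⁻¹) H := by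
      rw [cfc_mul _ _ H (hcont _) (hcont _), ← hGH, Matrix.conjTranspose_mul, hGsa, ← hG, hH]
      simp only [Matrix.mul_assoc]
    rw [h1]
    exact Matrix.nonneg_iff_posSemidef.mp (sub_nonneg.mpr (cfc_le_one _ _ fun t _ => mul_inv_le_one))
  · rw [Matrix.conjTranspose_mul, hGsa, Matrix.mul_assoc, ← hH, hGH, traceNorm, ← hH,
      sqrt_eq_cfc_real hpsd.nonneg]

theorem re_le_re_of_le {z w : ℂ} (h : z ≤ w) : z.re ≤ w.re := (Complex.le_def.mp h).1

omit [DecidableEq ι] in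
-- The quadratic polynomial `t ↦ f ((A + tB)(A + tB)†)` is nonnegative on the reals, so its
-- discriminant is not positive.
theorem cauchy_schwarz_of_positive {f : Op ι →ₗ[ℂ] ℂ} (hf : ∀ X : Op ι, X.PosSemidef → 0 ≤ f X)
    (A B : Op ι) : (f (A * B.conjTranspose) + f (B * A.conjTranspose)).re ≤
      2 * √((f (A * A.conjTranspose)).re * (f (B * B.conjTranspose)).re) := by
  have hnn (C : Op ι) : 0 ≤ (f (C * C.conjTranspose)).re :=
    re_le_re_of_le (hf _ (Matrix.posSemidef_self_mul_conjTranspose C))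
  set a := (f (A * A.conjTranspose)).re
  set b := (f (A * B.conjTranspose) + f (B * A.conjTranspose)).re with hb
  set c := (f (B * B.conjTranspose)).re with hc
  have key : discrim c b a ≤ 0 := by
    refine discrim_le_zero fun t => ?_
    refine (hnn (A + (t : ℂ) • B)).trans_eq ?_
    have : (A + (t : ℂ) • B) * (A + (t : ℂ) • B).conjTranspose = A * A.conjTranspose +
        (t : ℂ) • (A * B.conjTranspose + B * A.conjTranspose) +
          ((t * t : ℝ) : ℂ) • (B * B.conjTranspose) := by
      simp only [Matrix.conjTranspose_add, Matrix.conjTranspose_smul, Matrix.add_mul,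
        Matrix.mul_add, Matrix.smul_mul, Matrix.mul_smul, smul_smul, smul_add, Complex.star_def,
        Complex.conj_ofReal, Complex.ofReal_mul]
      abel
    rw [this, map_add, map_add, map_smul, map_smul, map_add, smul_eq_mul, smul_eq_mul,
      Complex.add_re, Complex.add_re, Complex.re_ofReal_mul, Complex.re_ofReal_mul, ← hb, ← hc]
    ring
  have h2 : b ^ 2 ≤ 4 * (a * c) := by
    rw [discrim] at key
    linarith
  have h3 : b ≤ √(4 * (a * c)) := Real.le_sqrt_of_sq_le h2
  rwa [Real.sqrt_mul (by norm_num), show (4 : ℝ) = 2 ^ 2 by norm_num,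
    Real.sqrt_sq (by norm_num)] at h3

theorem traceNorm_nonneg (X : Op ι) : 0 ≤ traceNorm X :=
  re_le_re_of_le (Matrix.nonneg_iff_posSemidef.mp (CFC.sqrt_nonneg _)).trace_nonneg

theorem fidelity_nonneg (ρ σ : Op ι) : 0 ≤ fidelity ρ σ := sq_nonneg _

theorem sqrt_fidelity (ρ σ : Op ι) : √(fidelity ρ σ) = traceNorm (CFC.sqrt ρ * CFC.sqrt σ) :=
  Real.sqrt_sq (traceNorm_nonneg _)

/-- A functional `f` with `0 ≤ f ≤ Tr` is the probability of an outcome of a measurement. -/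
def IsEffect (f : Op ι →ₗ[ℂ] ℂ) : Prop :=
  ∀ X : Op ι, X.PosSemidef → 0 ≤ f X ∧ f X ≤ X.trace

/-- With `W` from the polar decomposition, `√F = Re Tr (A B†)` for `A = √σ W†` and `B = √ρ`, where
`B B† = ρ` and `A A† ≤ σ`. Split the trace as `f + (Tr - f)` and apply Cauchy–Schwarz to each
positive part. -/
theorem sqrt_fidelity_le_of_isEffect {ρ σ : Op ι} (hρ : ρ.PosSemidef) (hρ1 : ρ.trace = 1)
    (hσ : σ.PosSemidef) (hσ1 : σ.trace = 1) {f : Op ι →ₗ[ℂ] ℂ} (hf : IsEffect f) :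
    √(fidelity ρ σ) ≤ √(f ρ).re + √(1 - (f σ).re) := by
  obtain ⟨W, hW, hWX⟩ := exists_contraction_traceNorm (CFC.sqrt ρ * CFC.sqrt σ)
  have hsa (τ : Op ι) : (CFC.sqrt τ).conjTranspose = CFC.sqrt τ :=
    (Matrix.nonneg_iff_posSemidef.mp (CFC.sqrt_nonneg τ)).isHermitian
  set A := CFC.sqrt σ * W.conjTranspose with hA
  set B := CFC.sqrt ρ with hB
  have hBB : B * B.conjTranspose = ρ := by
    rw [hsa, CFC.sqrt_mul_sqrt_self ρ hρ.nonneg]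
  have hAA : (σ - A * A.conjTranspose).PosSemidef := by
    have := hW.mul_mul_conjTranspose_same (CFC.sqrt σ)
    rw [hsa, Matrix.mul_sub, Matrix.sub_mul, Matrix.mul_one,
      CFC.sqrt_mul_sqrt_self σ hσ.nonneg] at this
    rw [hA, Matrix.conjTranspose_mul, hsa, Matrix.conjTranspose_conjTranspose]
    simpa only [Matrix.mul_assoc] using this
  have hmono {g : Op ι →ₗ[ℂ] ℂ} (hg : ∀ X : Op ι, X.PosSemidef → 0 ≤ g X) :
      (g (A * A.conjTranspose)).re ≤ (g σ).re := by
    have := re_le_re_of_le (hg _ hAA)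
    rw [map_sub, Complex.sub_re, Complex.zero_re] at this
    linarith
  set g : Op ι →ₗ[ℂ] ℂ := Matrix.traceLinearMap ι ℂ ℂ - f with hgdef
  have hg : ∀ X : Op ι, X.PosSemidef → 0 ≤ g X := fun X hX => by
    simpa [hgdef] using (hf X hX).2
  have hf' : ∀ X : Op ι, X.PosSemidef → 0 ≤ f X := fun X hX => (hf X hX).1
  have hAB : (A * B.conjTranspose).trace.re = traceNorm (CFC.sqrt ρ * CFC.sqrt σ) := by
    rw [← hWX, hA, hsa, Matrix.mul_assoc, Matrix.trace_mul_comm, Matrix.mul_assoc]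
  have hBA : (B * A.conjTranspose).trace.re = traceNorm (CFC.sqrt ρ * CFC.sqrt σ) := by
    rw [← hAB, ← Matrix.conjTranspose_conjTranspose B, ← Matrix.conjTranspose_mul,
      Matrix.conjTranspose_conjTranspose, Matrix.trace_conjTranspose]
    simp
  have h1 := cauchy_schwarz_of_positive hf' A B
  have h2 := cauchy_schwarz_of_positive hg A B
  rw [hBB] at h1 h2
  have gρ : (g ρ).re = 1 - (f ρ).re := by simp [hgdef, hρ1]
  have gσ : (g σ).re = 1 - (f σ).re := by simp [hgdef, hσ1]
  have gAB : (g (A * B.conjTranspose) + g (B * A.conjTranspose)).re =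
      2 * traceNorm (CFC.sqrt ρ * CFC.sqrt σ) -
        (f (A * B.conjTranspose) + f (B * A.conjTranspose)).re := by
    simp [hgdef, hAB, hBA]
    ring
  have fρ0 := re_le_re_of_le (hf' ρ hρ)
  have gρ0 := re_le_re_of_le (hg ρ hρ)
  have fσ0 := re_le_re_of_le (hf' σ hσ)
  have gσ0 := re_le_re_of_le (hg σ hσ)
  rw [Complex.zero_re] at fρ0 gρ0 fσ0 gσ0
  rw [sqrt_fidelity]
  -- In each product one factor is at most 1: here `f (A A†) ≤ f σ ≤ 1`, and below `g ρ ≤ 1`.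
  have b1 : √((f (A * A.conjTranspose)).re * (f ρ).re) ≤ √(f ρ).re := by
    refine Real.sqrt_le_sqrt ?_
    nlinarith [hmono hf']
  have b2 : √((g (A * A.conjTranspose)).re * (g ρ).re) ≤ √(1 - (f σ).re) := by
    refine Real.sqrt_le_sqrt ?_
    have := hmono hg
    have h0 : 0 ≤ (g (A * A.conjTranspose)).re :=
      re_le_re_of_le (hg _ (Matrix.posSemidef_self_mul_conjTranspose A))
    nlinarith
  linarith

/-- The overlap functional `X ↦ Tr (τ X)`. -/
def overlap (τ : Op ι) : Op ι →ₗ[ℂ] ℂ :=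
  Matrix.traceLinearMap ι ℂ ℂ ∘ₗ LinearMap.mulLeft ℂ τ

theorem overlap_apply (τ X : Op ι) : overlap τ X = (τ * X).trace := rfl

omit [DecidableEq ι] in
theorem trace_mul_nonneg {τ X : Op ι} (hτ : τ.PosSemidef) (hX : X.PosSemidef) :
    0 ≤ (τ * X).trace := by
  obtain ⟨B, rfl⟩ := posSemidef_iff_exists_mul_conjTranspose.mp hX
  rw [← Matrix.mul_assoc, Matrix.trace_mul_comm, ← Matrix.mul_assoc]
  exact (hτ.conjTranspose_mul_mul_same B).trace_nonneg

theorem IsPureState.isEffect {τ : Op ι} (hτ : IsPureState τ) : IsEffect (overlap τ) := by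
  intro X hX
  refine ⟨trace_mul_nonneg hτ.posSemidef hX, ?_⟩
  have h1 : (1 - τ).PosSemidef := by
    have h2 : (1 - τ) * (1 - τ).conjTranspose = 1 - τ := by
      rw [Matrix.conjTranspose_sub, hτ.posSemidef.isHermitian.eq, Matrix.conjTranspose_one,
        Matrix.mul_sub, Matrix.sub_mul, Matrix.sub_mul, hτ.mul_self]
      simp
    rw [← h2]
    exact Matrix.posSemidef_self_mul_conjTranspose _
  have := trace_mul_nonneg h1 hX
  rw [Matrix.sub_mul, Matrix.trace_sub, Matrix.one_mul] at this
  exact sub_nonneg.mp this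

/-- The measurement inequality for the test `τ` itself, which `τ` passes with certainty, so that the
second root vanishes. -/
theorem fidelity_le_overlap {ρ τ : Op ι} (hρ : ρ.PosSemidef) (hρ1 : ρ.trace = 1)
    (hτ : IsPureState τ) : fidelity ρ τ ≤ (overlap τ ρ).re := by
  have h := sqrt_fidelity_le_of_isEffect hρ hρ1 hτ.posSemidef hτ.trace_eq_one hτ.isEffect
  rw [overlap_apply τ τ, hτ.mul_self, hτ.trace_eq_one] at h
  simp only [Complex.one_re, sub_self, Real.sqrt_zero, add_zero] at h
  exact (Real.sqrt_le_sqrt_iff (re_le_re_of_le (hτ.isEffect ρ hρ).1)).mp h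

omit [DecidableEq ι] in
theorem IsEffect.comp {κ : Type} [Fintype κ] {f : Op κ →ₗ[ℂ] ℂ} (hf : IsEffect f)
    {G : OpMap ι κ} (hG : ∀ X : Op ι, X.PosSemidef → (G X).PosSemidef)
    (htr : ∀ X : Op ι, (G X).trace = X.trace) : IsEffect (f ∘ₗ G) :=
  fun X hX => ⟨(hf _ (hG X hX)).1, (hf _ (hG X hX)).2.trans_eq (htr X)⟩

theorem supportProj_of_isPureState {ρ : Op ι} (h : IsPureState ρ) : supportProj ρ = ρ := by
  have hsa : IsSelfAdjoint ρ := h.posSemidef.isHermitian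
  have hid : IsIdempotentElem ρ := h.mul_self
  rw [supportProj]
  conv_rhs => rw [← cfc_id ℝ ρ hsa]
  refine cfc_congr fun t ht => ?_
  rcases hid.spectrum_subset ℝ ht with rfl | rfl <;> simp

theorem stateDmin_of_isPureState {ρ : Op ι} (h : IsPureState ρ) (σ : Op ι) :
    stateDmin ρ σ = negLog2 (overlap ρ σ).re := by
  rw [stateDmin, supportProj_of_isPureState h, overlap_apply]

end

theorem chanFidelity_le {ι κ : Type} [Fintype ι] [Fintype κ] [DecidableEq κ] (Φ Ψ : OpMap ι κ)
    (ψ : PureInput ι) : chanFidelity Φ Ψ ≤ fidelity (outState Φ ψ) (outState Ψ ψ) :=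
  ciInf_le ⟨0, by rintro _ ⟨ψ, rfl⟩; exact fidelity_nonneg _ _⟩ ψ

theorem chanFidelity_nonneg {ι κ : Type} [Fintype ι] [Fintype κ] [DecidableEq κ]
    (Φ Ψ : OpMap ι κ) : 0 ≤ chanFidelity Φ Ψ :=
  Real.iInf_nonneg fun _ => fidelity_nonneg _ _

/-! ### Superchannels and overlaps -/

theorem fidelity_le_one {ι : Type} [Fintype ι] [DecidableEq ι] {ρ σ : Op ι} (hρ : ρ.PosSemidef)
    (hρ1 : ρ.trace = 1) (hσ : σ.PosSemidef) (hσ1 : σ.trace = 1) : fidelity ρ σ ≤ 1 := by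
  have h := sqrt_fidelity_le_of_isEffect hρ hρ1 hσ hσ1 (f := 0)
    fun X hX => ⟨le_rfl, hX.trace_nonneg⟩
  simpa using h

instance PureInput.instNonempty {ι : Type} [Fintype ι] [Nonempty ι] : Nonempty (PureInput ι) := by
  classical
  obtain ⟨i⟩ := ‹Nonempty ι›
  exact ⟨⟨1, _, Pi.single (0, i) 1, by simp, rfl⟩⟩

/-- The pre-processed input may be mixed, whereas channel fidelity ranges over pure inputs. After
purification, everything that follows the inner channel, including the final test, is a single
effect on its output. -/
theorem sqrt_chanFidelity_le {ι κ ι' κ' : Type} [Fintype ι] [Fintype κ] [DecidableEq κ]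
    [Fintype ι'] [Fintype κ'] [DecidableEq κ'] {Θ : OpMap ι κ →ₗ[ℂ] OpMap ι' κ'}
    (hΘ : IsSuperchannel Θ) {Φ Ψ : OpMap ι κ} (hΦ : IsChannel Φ) (hΨ : IsChannel Ψ)
    (ψ : PureInput ι') {τ : Op (Fin ψ.refDim × κ')} (hτ : IsPureState τ) :
    √(chanFidelity Φ Ψ) ≤
      √(overlap τ (outState (Θ Φ) ψ)).re + √(1 - (overlap τ (outState (Θ Ψ) ψ)).re) := by
  obtain ⟨m, Pre, Post, hPre, hPost, hΘ⟩ := hΘ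
  have htr : (idTensor (Fin ψ.refDim) Pre ψ.state).trace = 1 := trace_outState hPre ψ
  obtain ⟨ρ, hρ, hpre⟩ := exists_pure_ptrace (outState_posSemidef hPre.1 ψ) htr
  -- The purifying system; it joins the old reference and the memory in the reference of the new
  -- input `ψ'`.
  let J := Fin ψ.refDim × Fin m × ι
  let e := (Fintype.equivFin ((J × Fin ψ.refDim) × Fin m)).symm
  let E (α : Type) : Fin (Fintype.card ((J × Fin ψ.refDim) × Fin m)) × α ≃
      J × Fin ψ.refDim × Fin m × α :=
    (e.prodCongr (Equiv.refl α)).trans ((Equiv.prodAssoc _ _ _).trans (Equiv.prodAssoc _ _ _))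
  let ψ' : PureInput ι := ⟨_, _, hρ.submatrix (E ι)⟩
  -- Discard the purifying system, then post-process. This map does not depend on the inner channel.
  let G : OpMap (Fin ψ'.refDim × κ) (Fin ψ.refDim × κ') :=
    idTensor (Fin ψ.refDim) Post ∘ₗ ptrace J (Fin ψ.refDim × Fin m × κ) ∘ₗ
      (Matrix.reindexLinearEquiv ℂ ℂ (E κ) (E κ)).toLinearMap
  have hG (N : OpMap ι κ) : outState (Θ N) ψ = G (outState N ψ') := by
    have h1 : Matrix.reindexLinearEquiv ℂ ℂ (E κ) (E κ) (outState N ψ') =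
        idTensor J (idTensor (Fin ψ.refDim) (idTensor (Fin m) N)) ρ := by
      have h2 : outState N ψ' = (idTensor J (idTensor (Fin ψ.refDim) (idTensor (Fin m) N))
        ρ).submatrix (E κ) (E κ) := rfl
      rw [h2]
      ext a b
      simp
    have h3 : outState (Θ N) ψ = idTensor (Fin ψ.refDim) Post (idTensor (Fin ψ.refDim)
        (idTensor (Fin m) N) (outState Pre ψ)) := by
      rw [hΘ]
      rfl
    rw [h3, hpre, idTensor_ptrace]
    simp only [G, LinearMap.comp_apply, LinearEquiv.coe_coe, h1]
    rfl
  have hGeff : IsEffect (overlap τ ∘ₗ G) := by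
    refine hτ.isEffect.comp (fun X hX => ?_) fun X => ?_
    · exact hPost.1 _ _ (ptrace_posSemidef (hX.submatrix _))
    · simp only [G, LinearMap.comp_apply, LinearEquiv.coe_coe]
      rw [trace_idTensor hPost.2, trace_ptrace]
      exact trace_submatrix_equiv (E κ).symm X
  have : √(fidelity (outState Φ ψ') (outState Ψ ψ')) ≤
      √(overlap τ (G (outState Φ ψ'))).re + √(1 - (overlap τ (G (outState Ψ ψ'))).re) :=
    sqrt_fidelity_le_of_isEffect (outState_posSemidef hΦ.1 ψ') (trace_outState hΦ ψ')
      (outState_posSemidef hΨ.1 ψ') (trace_outState hΨ ψ') hGeff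
  rw [← hG, ← hG] at this
  exact (Real.sqrt_le_sqrt (chanFidelity_le Φ Ψ ψ')).trans this

theorem sq_div_four_le_of_sqrt_le {F₁ F₂ p q η : ℝ} (hη : 0 ≤ η) (hF₁ : F₁ ≤ 1)
    (hF₂ : 0 ≤ F₂) (h : 1 + η ≤ F₁ + F₂) (hq : F₂ ≤ q) (hq1 : q ≤ 1) (hp : 0 ≤ p)
    (hs : √F₁ ≤ √p + √(1 - q)) : η ^ 2 / 4 ≤ p := by
  have h1 : √(1 - q) ≤ √(1 - F₂) := Real.sqrt_le_sqrt (by linarith)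
  have h0 : 0 ≤ F₁ := by linarith
  have a0 := Real.sqrt_nonneg F₁
  have a1 : √F₁ ≤ 1 := Real.sqrt_le_one.mpr hF₁
  have b0 := Real.sqrt_nonneg (1 - F₂)
  have b1 : √(1 - F₂) ≤ 1 := Real.sqrt_le_one.mpr (by linarith)
  have a2 := Real.sq_sqrt h0
  have b2 := Real.sq_sqrt (show 0 ≤ 1 - F₂ by linarith)
  -- `η ≤ F₁ - (1 - F₂)` is a difference of squares. The sum of the roots is at most 2, so their
  -- difference is at least `η / 2`.
  have key : η ≤ (√F₁ - √(1 - F₂)) * (√F₁ + √(1 - F₂)) := by nlinarith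
  have hpos : 0 ≤ √F₁ - √(1 - F₂) := by
    by_contra hneg
    push Not at hneg
    nlinarith
  have h2 : η / 2 ≤ √p := by nlinarith
  have := pow_le_pow_left₀ (by positivity) h2 2
  rw [Real.sq_sqrt hp] at this
  linarith

theorem outState_smul_sub {ι κ : Type} [Fintype ι] (z : ℝ) (Φ Ψ : OpMap ι κ) (ψ : PureInput ι) :
    outState (z • Φ - Ψ) ψ = z • outState Φ ψ - outState Ψ ψ := rfl

theorem overlap_le_of_isCP {ι κ : Type} [Fintype ι] [Fintype κ] [DecidableEq κ] {z : ℝ}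
    {Φ Ψ : OpMap ι κ} (h : IsCP (z • Φ - Ψ)) (ψ : PureInput ι) {τ : Op (Fin ψ.refDim × κ)}
    (hτ : τ.PosSemidef) :
    (overlap τ (outState Ψ ψ)).re ≤ z * (overlap τ (outState Φ ψ)).re := by
  have := re_le_re_of_le (trace_mul_nonneg hτ (outState_posSemidef h ψ))
  rw [← overlap_apply, outState_smul_sub, map_sub, LinearMap.map_smul_of_tower, Complex.sub_re,
    Complex.smul_re, Complex.zero_re, smul_eq_mul] at this
  linarith

theorem negLog2_le_of_le {x z : ℝ} {l : ℝ} (hz : 0 < z) (h : z ≤ (2 : ℝ) ^ l * x) :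
    negLog2 x ≤ ((l - Real.logb 2 z : ℝ) : EReal) := by
  have h2 : (0 : ℝ) < 2 ^ l := Real.rpow_pos_of_pos two_pos l
  have hx : 0 < x := pos_of_mul_pos_right (hz.trans_le h) h2.le
  rw [negLog2, if_neg hx.not_ge, EReal.coe_le_coe_iff]
  have := Real.logb_le_logb_of_le one_lt_two hz h
  rw [Real.logb_mul h2.ne' hx.ne', Real.logb_rpow two_pos (by norm_num)] at this
  linarith

/-- One-shot inequality: with `τ` the pure output of `T'`, `η ^ 2 / 4 ≤ Tr (τ Θ₂Θ₁T(ψ)) ≤ 2 ^ l * Tr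
(τ Θ₂Θ₁M(ψ))` for every input `ψ`. -/
theorem chanDmin_le_of_superchannels {ι κ ι' κ' ι'' κ'' : Type} [Fintype ι] [Fintype κ]
    [Fintype ι'] [Nonempty ι'] [Fintype κ'] [DecidableEq κ'] [Fintype ι''] [Fintype κ'']
    [DecidableEq κ''] {Θ₁ : OpMap ι κ →ₗ[ℂ] OpMap ι' κ'} {Θ₂ : OpMap ι' κ' →ₗ[ℂ] OpMap ι'' κ''}
    (hΘ₁ : IsSuperchannel Θ₁) (hΘ₂ : IsSuperchannel Θ₂) {T M : OpMap ι κ} (hT : IsChannel T)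
    {E : OpMap ι' κ'} (hE : IsChannel E) {T' : OpMap ι'' κ''} (hT' : IsPureChannel T') {η l : ℝ}
    (hη : 0 < η) (hF : 1 + η ≤ chanFidelity (Θ₁ T) E + chanFidelity (Θ₂ E) T')
    (hM : IsCP ((2 : ℝ) ^ l • M - T)) :
    chanDmin T' (Θ₂ (Θ₁ M)) ≤ ((l - Real.logb 2 (η ^ 2 / 4) : ℝ) : EReal) := by
  refine iSup_le fun ψ => ?_
  rw [stateDmin_of_isPureState (hT' ψ)]
  refine negLog2_le_of_le (by positivity) ?_
  have hCP : IsCP ((2 : ℝ) ^ l • Θ₂ (Θ₁ M) - Θ₂ (Θ₁ T)) := by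
    have := hΘ₂.isCP (hΘ₁.isCP hM)
    rwa [map_sub, map_sub, LinearMap.map_smul_of_tower, LinearMap.map_smul_of_tower] at this
  refine le_trans ?_ (overlap_le_of_isCP hCP ψ (hT' ψ).posSemidef)
  have hT₁ := hΘ₁.isChannel hT
  have hE₂ := hΘ₂.isChannel hE
  have hTT := hΘ₂.isChannel hT₁
  have hF₁ : chanFidelity (Θ₁ T) E ≤ 1 := by
    obtain ⟨φ⟩ : Nonempty (PureInput ι') := inferInstance
    exact (chanFidelity_le _ _ φ).trans (fidelity_le_one (outState_posSemidef hT₁.1 φ)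
      (trace_outState hT₁ φ) (outState_posSemidef hE.1 φ) (trace_outState hE φ))
  have hF₂ : chanFidelity (Θ₂ E) T' ≤ (overlap (outState T' ψ) (outState (Θ₂ E) ψ)).re :=
    (chanFidelity_le _ _ ψ).trans
      (fidelity_le_overlap (outState_posSemidef hE₂.1 ψ) (trace_outState hE₂ ψ) (hT' ψ))
  have hq := re_le_re_of_le ((hT' ψ).isEffect _ (outState_posSemidef hE₂.1 ψ)).2
  rw [trace_outState hE₂, Complex.one_re] at hq
  have hp := re_le_re_of_le ((hT' ψ).isEffect _ (outState_posSemidef hTT.1 ψ)).1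
  exact sq_div_four_le_of_sqrt_le hη.le hF₁ (chanFidelity_nonneg _ _) hF hF₂ hq hp
    (sqrt_chanFidelity_le hΘ₂ hT₁ hE ψ (hT' ψ))

/-! ### Max-relative entropy measure -/

section
variable {L : Type*} {dim : L → ℕ+} {s t s' t' : List L} {O : MapFamily dim}

instance Idx.instNonempty : (s : List L) → Nonempty (Idx dim s)
  | [] => inferInstanceAs (Nonempty Unit)
  | a :: s =>
    haveI := Idx.instNonempty s
    inferInstanceAs (Nonempty (Fin (dim a) × Idx dim s))

theorem Dmax_le {Φ M : SysMap dim s t} {l : ℝ} (hM : M ∈ O s t)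
    (h : IsCP ((2 : ℝ) ^ l • M - Φ)) : Dmax O Φ ≤ l :=
  (iInf₂_le M hM).trans (iSup_le fun ψ => sInf_le ⟨l, rfl, outState_posSemidef h ψ⟩)

/-- Each pure input supplies its own exponent below `l`; all can be raised to `l` because the
outputs of `M` are positive. -/
theorem exists_isCP_of_Dmax_lt (hO : ∀ M ∈ O s t, IsChannel M) {Φ : SysMap dim s t} {l : ℝ}
    (h : Dmax O Φ < l) : ∃ M ∈ O s t, IsCP ((2 : ℝ) ^ l • M - Φ) := by
  simp only [Dmax, iInf_lt_iff] at h
  obtain ⟨M, hM, h⟩ := h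
  refine ⟨M, hM, isCP_of_pureInput fun ψ => ?_⟩
  obtain ⟨_, ⟨l', rfl, hl'⟩, hlt⟩ := sInf_lt_iff.mp ((le_iSup _ ψ).trans_lt h)
  have hle : (2 : ℝ) ^ l' ≤ 2 ^ l :=
    Real.rpow_le_rpow_of_exponent_le one_le_two (EReal.coe_lt_coe_iff.mp hlt).le
  have := hl'.add ((outState_posSemidef (hO M hM).1 ψ).smul (sub_nonneg.mpr hle))
  rw [outState_smul_sub]
  convert this using 1
  rw [sub_smul]
  abel

theorem Dmax_nonneg (hO : ∀ M ∈ O s t, IsChannel M) {Φ : SysMap dim s t} (hΦ : IsChannel Φ) :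
    0 ≤ Dmax O Φ := by
  refine le_iInf₂ fun M hM => ?_
  obtain ⟨ψ⟩ : Nonempty (PureInput (Idx dim s)) := inferInstance
  refine le_iSup_of_le ψ (le_sInf ?_)
  rintro _ ⟨l, rfl, hl⟩
  have := re_le_re_of_le hl.trace_nonneg
  rw [Matrix.trace_sub, Matrix.trace_smul, trace_outState (hO M hM), trace_outState hΦ] at this
  simp only [Complex.zero_re, Complex.sub_re, Complex.smul_re, Complex.one_re, smul_eq_mul,
    mul_one, sub_nonneg] at this
  rw [← EReal.coe_zero, EReal.coe_le_coe_iff]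
  by_contra hneg
  exact this.not_gt (Real.rpow_lt_one_of_one_lt_of_neg one_lt_two (not_le.mp hneg))

theorem Dmax_sysTensor_le (hO : ∀ (s t : List L), ∀ M ∈ O s t, IsChannel M)
    (hOtensor : ∀ (s t s' t' : List L), ∀ M ∈ O s t, ∀ M' ∈ O s' t',
      sysTensor M M' ∈ O (s ++ s') (t ++ t'))
    {Φ : SysMap dim s t} {Ψ : SysMap dim s' t'} (hΦ : IsChannel Φ) (hΨ : IsChannel Ψ) :
    Dmax O (sysTensor Φ Ψ) ≤ Dmax O Φ + Dmax O Ψ := by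
  have h1 := (EReal.bot_lt_zero.trans_le (Dmax_nonneg (hO s t) hΦ)).ne'
  have h2 := (EReal.bot_lt_zero.trans_le (Dmax_nonneg (hO s' t') hΨ)).ne'
  refine EReal.le_add_of_forall_gt (.inl h1) (.inr h2) fun a ha b hb => ?_
  obtain ⟨x, hx, hxa⟩ := EReal.lt_iff_exists_real_btwn.mp ha
  obtain ⟨y, hy, hyb⟩ := EReal.lt_iff_exists_real_btwn.mp hb
  obtain ⟨M, hM, hMΦ⟩ := exists_isCP_of_Dmax_lt (hO s t) hx
  obtain ⟨M', hM', hMΨ⟩ := exists_isCP_of_Dmax_lt (hO s' t') hy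
  have hy0 : (0 : ℝ) ≤ 2 ^ y := Real.rpow_nonneg zero_le_two y
  -- The difference is `(2^x M - Φ) ⊗ 2^y M' + Φ ⊗ (2^y M' - Ψ)`, a sum of completely positive maps.
  have hCP : IsCP ((2 : ℝ) ^ (x + y) • sysTensor M M' - sysTensor Φ Ψ) := by
    have := (hMΦ.sysTensor ((hO _ _ M' hM').1.smul hy0)).add (hΦ.1.sysTensor hMΨ)
    convert this using 1
    rw [sysTensor_sub_left, sysTensor_sub_right, sysTensor_smul_left, sysTensor_smul_right,
      sysTensor_smul_right, smul_smul, ← Real.rpow_add two_pos]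
    abel
  refine (Dmax_le (hOtensor _ _ _ _ M hM M' hM') hCP).trans ?_
  rw [EReal.coe_add]
  exact add_le_add hxa.le hyb.le

theorem Dmax_congr {Φ : SysMap dim s t} {Ψ : SysMap dim s' t'} (hs : s = s') (ht : t = t')
    (h : HEq Φ Ψ) : Dmax O Φ = Dmax O Ψ := by
  subst hs ht
  rw [eq_of_heq h]

/-! ### Min-relative entropy measure -/

theorem Dmin_congr {Φ : SysMap dim s t} {Ψ : SysMap dim s' t'} (hs : s = s') (ht : t = t')
    (h : HEq Φ Ψ) : Dmin O Φ = Dmin O Ψ := by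
  subst hs ht
  rw [eq_of_heq h]

theorem negLog2_nonneg {x : ℝ} (h : x ≤ 1) : 0 ≤ negLog2 x := by
  rw [negLog2]
  split_ifs with hx
  · exact le_top
  · rw [← EReal.coe_zero, EReal.coe_le_coe_iff]
    linarith [Real.logb_nonpos one_lt_two (not_le.mp hx).le h]

theorem negLog2_mul {x y : ℝ} (hx : 0 ≤ x) (hy : 0 ≤ y) :
    negLog2 (x * y) = negLog2 x + negLog2 y := by
  have hbot (z : ℝ) : negLog2 z ≠ ⊥ := by
    rw [negLog2]
    split_ifs
    · exact top_ne_bot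
    · exact EReal.coe_ne_bot _
  rcases hx.eq_or_lt with rfl | hx
  · rw [zero_mul, show negLog2 0 = ⊤ from if_pos le_rfl, EReal.top_add_of_ne_bot (hbot y)]
  rcases hy.eq_or_lt with rfl | hy
  · rw [mul_zero, show negLog2 0 = ⊤ from if_pos le_rfl, EReal.add_top_of_ne_bot (hbot x)]
  rw [negLog2, negLog2, negLog2, if_neg (mul_pos hx hy).not_ge, if_neg hx.not_ge,
    if_neg hy.not_ge, ← EReal.coe_add, Real.logb_mul hx.ne' hy.ne', neg_add]

theorem Dmin_nonneg (hO : ∀ M ∈ O s t, IsChannel M) {Φ : SysMap dim s t} (hΦ : IsPureChannel Φ) :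
    0 ≤ Dmin O Φ := by
  refine le_iInf₂ fun M hM => ?_
  obtain ⟨ψ⟩ : Nonempty (PureInput (Idx dim s)) := inferInstance
  refine le_iSup_of_le ψ ?_
  rw [stateDmin_of_isPureState (hΦ ψ)]
  have := re_le_re_of_le ((hΦ ψ).isEffect _ (outState_posSemidef (hO M hM).1 ψ)).2
  rw [trace_outState (hO M hM), Complex.one_re] at this
  exact negLog2_nonneg this

open scoped Kronecker in
theorem outState_eq_kronecker {ι κ : Type} [Fintype ι] [DecidableEq ι] [Subsingleton ι]
    (Φ : OpMap ι κ) (ψ : PureInput ι) (i : ι) :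
    outState Φ ψ = (ψ.state.submatrix (fun a => (a, i)) (fun a => (a, i))) ⊗ₖ Φ 1 := by
  ext p q
  have h : (Matrix.of fun a a' => ψ.state (p.1, a) (q.1, a')) = ψ.state (p.1, i) (q.1, i) • 1 := by
    ext a b
    obtain rfl := Subsingleton.elim a i
    obtain rfl := Subsingleton.elim b a
    simp
  rw [outState, idTensor_apply, h, map_smul]
  rfl

/-- Both outputs are products with the same pure reference state, which contributes the factor `Tr
ρ² = 1`. -/
theorem overlap_outState_eq {ι κ : Type} [Fintype ι] [DecidableEq ι] [Subsingleton ι] [Nonempty ι]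
    [Fintype κ] [DecidableEq κ] (Φ Ψ : OpMap ι κ) (ψ : PureInput ι) :
    overlap (outState Φ ψ) (outState Ψ ψ) = overlap (Φ 1) (Ψ 1) := by
  obtain ⟨i⟩ := ‹Nonempty ι›
  let e : Fin ψ.refDim ≃ Fin ψ.refDim × ι :=
    ⟨fun a => (a, i), Prod.fst, fun _ => rfl, fun p => Prod.ext rfl (Subsingleton.elim _ _)⟩
  have hpure := ψ.pure.submatrix e
  rw [overlap_apply, overlap_apply, outState_eq_kronecker Φ ψ i, outState_eq_kronecker Ψ ψ i,
    ← Matrix.mul_kronecker_mul, Matrix.trace_kronecker]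
  change (ψ.state.submatrix e e * ψ.state.submatrix e e).trace * _ = _
  rw [hpure.mul_self, hpure.trace_eq_one, one_mul]

theorem chanDmin_eq_of_subsingleton [Subsingleton (Idx dim s)] {Φ : SysMap dim s t}
    (hΦ : IsPureChannel Φ) (M : SysMap dim s t) :
    chanDmin Φ M = negLog2 (overlap (Φ 1) (M 1)).re := by
  rw [chanDmin]
  simp only [stateDmin_of_isPureState (hΦ _), overlap_outState_eq]
  exact ciSup_const

open scoped Kronecker in
theorem sysTensor_one [Subsingleton (Idx dim s)] [Subsingleton (Idx dim s')]
    (Φ : SysMap dim s t) (Ψ : SysMap dim s' t') :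
    sysTensor Φ Ψ 1 = (Φ 1 ⊗ₖ Ψ 1).submatrix (Idx.appendEquiv dim t t')
      (Idx.appendEquiv dim t t') := by
  have hsub : Subsingleton (Idx dim (s ++ s')) := (Idx.appendEquiv dim s s').subsingleton
  ext p q
  have h1 (y y' : Idx dim s') : (Matrix.of fun x x' : Idx dim s => (1 : Op (Idx dim (s ++ s')))
      ((Idx.appendEquiv dim s s').symm (x, y)) ((Idx.appendEquiv dim s s').symm (x', y'))) = 1 := by
    ext x x'
    obtain rfl := Subsingleton.elim x x'
    obtain rfl := Subsingleton.elim y y'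
    simp
  have h2 (z : ℂ) : (Matrix.of fun _ _ : Idx dim s' => z) = z • 1 := by
    ext y y'
    obtain rfl := Subsingleton.elim y y'
    simp
  rw [sysTensor_apply]
  simp only [h1]
  rw [h2, map_smul]
  rfl

theorem overlap_sysTensor [Subsingleton (Idx dim s)] [Subsingleton (Idx dim s')]
    (Φ M : SysMap dim s t) (Ψ N : SysMap dim s' t') :
    overlap (sysTensor Φ Ψ 1) (sysTensor M N 1) =
      overlap (Φ 1) (M 1) * overlap (Ψ 1) (N 1) := by
  rw [overlap_apply, sysTensor_one, sysTensor_one, Matrix.submatrix_mul_equiv,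
    trace_submatrix_equiv, ← Matrix.mul_kronecker_mul, Matrix.trace_kronecker]
  rfl

theorem Dmin_sysTensor_le [Subsingleton (Idx dim s)] [Subsingleton (Idx dim s')]
    (hO : ∀ (s t : List L), ∀ M ∈ O s t, IsChannel M)
    (hOtensor : ∀ (s t s' t' : List L), ∀ M ∈ O s t, ∀ M' ∈ O s' t',
      sysTensor M M' ∈ O (s ++ s') (t ++ t'))
    {Φ : SysMap dim s t} {Ψ : SysMap dim s' t'} (hΦ : IsChannel Φ) (hΦp : IsPureChannel Φ)
    (hΨ : IsChannel Ψ) (hΨp : IsPureChannel Ψ) :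
    Dmin O (sysTensor Φ Ψ) ≤ Dmin O Φ + Dmin O Ψ := by
  have hsub : Subsingleton (Idx dim (s ++ s')) := (Idx.appendEquiv dim s s').subsingleton
  have h1 := (EReal.bot_lt_zero.trans_le (Dmin_nonneg (hO s t) hΦp)).ne'
  have h2 := (EReal.bot_lt_zero.trans_le (Dmin_nonneg (hO s' t') hΨp)).ne'
  refine EReal.le_add_of_forall_gt (.inl h1) (.inr h2) fun a ha b hb => ?_
  simp only [Dmin, gt_iff_lt, iInf_lt_iff] at ha hb
  obtain ⟨M, hM, hMa⟩ := ha
  obtain ⟨N, hN, hNb⟩ := hb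
  refine (iInf₂_le _ (hOtensor _ _ _ _ M hM N hN)).trans (le_trans ?_ (add_le_add hMa.le hNb.le))
  rw [chanDmin_eq_of_subsingleton (hΦp.sysTensor hΨp), chanDmin_eq_of_subsingleton hΦp,
    chanDmin_eq_of_subsingleton hΨp, overlap_sysTensor]
  have hnn {a b : List L} {A B : SysMap dim a b} (hA : IsCP A) (hB : IsCP B) :
      0 ≤ overlap (A 1) (B 1) :=
    trace_mul_nonneg (hA.apply_posSemidef Matrix.PosSemidef.one)
      (hB.apply_posSemidef Matrix.PosSemidef.one)
  have hx := Complex.le_def.mp (hnn hΦ.1 (hO _ _ M hM).1)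
  have hy := Complex.le_def.mp (hnn hΨ.1 (hO _ _ N hN).1)
  -- Both overlaps are real, so the real part is multiplicative.
  rw [Complex.mul_re, ← hx.2, Complex.zero_im, zero_mul, sub_zero, negLog2_mul hx.1 hy.1]

theorem subsingleton_idx_sysPow [Subsingleton (Idx dim s)] (n : ℕ) :
    Subsingleton (Idx dim (sysPow s n)) := by
  induction n with
  | zero => exact inferInstanceAs (Subsingleton Unit)
  | succ n ih => exact (Idx.appendEquiv dim s (sysPow s n)).subsingleton

end

/-! ### Regularization -/

theorem tendsto_div_of_subadditive {D : ℕ → EReal} (h0 : ∀ n, 0 ≤ D n)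
    (hadd : ∀ m n, D (m + n) ≤ D m + D n) (h1 : D 1 < ⊤) :
    ∃ l : ℝ, Tendsto (fun n : ℕ => D n / (n : EReal)) atTop (𝓝 (l : EReal)) := by
  have hfin : ∀ n, D (n + 1) ≠ ⊤ := by
    intro n
    induction n with
    | zero => exact h1.ne
    | succ n ih => exact ((hadd (n + 1) 1).trans_lt (EReal.add_lt_top ih h1.ne)).ne
  have hcoe : ∀ n, n ≠ 0 → ((D n).toReal : EReal) = D n := by
    intro n hn
    obtain ⟨k, rfl⟩ := Nat.exists_eq_succ_of_ne_zero hn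
    exact EReal.coe_toReal (hfin k) (EReal.bot_lt_zero.trans_le (h0 _)).ne'
  -- `D 0` may be `⊤`, since the trivial identity channel need not be free; the value at 0 is reset
  -- to 0.
  let u : ℕ → ℝ := fun n => if n = 0 then 0 else (D n).toReal
  have hu : Subadditive u := by
    intro m n
    by_cases hm : m = 0
    · simp [u, hm]
    by_cases hn : n = 0
    · simp [u, hn]
    have hmn : m + n ≠ 0 := by omega
    simp only [u, hm, hn, hmn, if_false]
    rw [← EReal.coe_le_coe_iff, EReal.coe_add, hcoe _ hm, hcoe _ hn, hcoe _ hmn]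
    exact hadd m n
  have hu0 : ∀ n, 0 ≤ u n := fun n => by
    simp only [u]
    split_ifs
    · exact le_rfl
    · exact EReal.toReal_nonneg (h0 n)
  have hbdd : BddBelow (Set.range fun n => u n / n) :=
    ⟨0, by rintro _ ⟨n, rfl⟩; exact div_nonneg (hu0 n) n.cast_nonneg⟩
  refine ⟨hu.lim, ((continuous_coe_real_ereal.tendsto _).comp (hu.tendsto_lim hbdd)).congr' ?_⟩
  filter_upwards [eventually_ne_atTop 0] with n hn
  simp only [Function.comp_apply, EReal.coe_div, u, hn, if_false, hcoe n hn]
  rfl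

/-- Squeeze with reals `x` below the liminf and `y` above the limsup: infinitely often `x ⌊dn⌋ < y
⌈cn⌉ + C`, and division by `n` gives `x d ≤ y c`. For `c = 0` only `b 0` enters, which the limsup
does not control, hence the separate hypothesis. -/
theorem mul_liminf_le_mul_limsup {a b : ℕ → EReal} (hb : ∀ n, 0 ≤ b n) {d c C : ℝ} (hd : 0 < d)
    (hc : 0 ≤ c) (hc0 : c = 0 → b 0 ≤ 0)
    (h : ∃ᶠ n : ℕ in atTop, a ⌊d * n⌋₊ ≤ b ⌈c * n⌉₊ + C) :
    (d : EReal) * liminf (fun n : ℕ => a n / (n : EReal)) atTop ≤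
      (c : EReal) * limsup (fun n : ℕ => b n / (n : EReal)) atTop := by
  set l := liminf (fun n : ℕ => a n / (n : EReal)) atTop with hl
  set r := limsup (fun n : ℕ => b n / (n : EReal)) atTop with hr
  have hk : Tendsto (fun n : ℕ => ⌊d * n⌋₊) atTop atTop :=
    tendsto_nat_floor_atTop.comp (tendsto_natCast_atTop_atTop.const_mul_atTop hd)
  -- For `c = 0` the number `y` is arbitrary, so this also covers an infinite limsup.
  have key : ∀ x : ℝ, (x : EReal) < l → ∀ y : ℝ, (0 < c → r < y) → x * d ≤ y * c := by
    intro x hx y hy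
    have ha : ∀ᶠ n : ℕ in atTop, ((x * ⌊d * n⌋₊ : ℝ) : EReal) < a ⌊d * n⌋₊ := by
      have h1 := hk.eventually ((eventually_lt_of_lt_liminf hx).and (eventually_gt_atTop 0))
      filter_upwards [h1] with n hn
      have := (EReal.lt_div_iff (Nat.cast_pos'.mpr hn.2) (EReal.natCast_ne_top _)).mp hn.1
      rwa [EReal.coe_mul]
    have hb' : ∀ᶠ n : ℕ in atTop, b ⌈c * n⌉₊ ≤ ((y * ⌈c * n⌉₊ : ℝ) : EReal) := by
      rcases hc.eq_or_lt with rfl | hc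
      · exact Eventually.of_forall fun n => by simpa using hc0 rfl
      have hm : Tendsto (fun n : ℕ => ⌈c * n⌉₊) atTop atTop :=
        tendsto_nat_ceil_atTop.comp (tendsto_natCast_atTop_atTop.const_mul_atTop hc)
      have h1 := hm.eventually ((eventually_lt_of_limsup_lt (hy hc)).and (eventually_gt_atTop 0))
      filter_upwards [h1] with n hn
      have := (EReal.div_lt_iff (Nat.cast_pos'.mpr hn.2) (EReal.natCast_ne_top _)).mp hn.1
      rw [EReal.coe_mul]
      exact this.le
    by_contra! hlt
    have hlim : Tendsto (fun n : ℕ => x * ((⌊d * n⌋₊ : ℝ) / n) - y * ((⌈c * n⌉₊ : ℝ) / n) - C / n)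
        atTop (𝓝 (x * d - y * c - 0)) :=
      ((((tendsto_nat_floor_mul_div_atTop hd.le).comp tendsto_natCast_atTop_atTop).const_mul x).sub
        (((tendsto_nat_ceil_mul_div_atTop hc).comp tendsto_natCast_atTop_atTop).const_mul y)).sub
          (tendsto_const_div_atTop_nhds_zero_nat C)
    have hpos := hlim.eventually (eventually_gt_nhds (by linarith : (0 : ℝ) < x * d - y * c - 0))
    obtain ⟨n, hn, hna, hnb, hnp, hn0⟩ := (h.and_eventually (ha.and (hb'.and (hpos.and
      (eventually_gt_atTop 0))))).exists
    have h2 : x * ⌊d * n⌋₊ < y * ⌈c * n⌉₊ + C := by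
      rw [← EReal.coe_lt_coe_iff, EReal.coe_add]
      exact hna.trans_le (hn.trans (add_le_add_left hnb _))
    have hn' : (0 : ℝ) < n := Nat.cast_pos.mpr hn0
    have h3 : 0 < (x * ⌊d * n⌋₊ - y * ⌈c * n⌉₊ - C) / n := by
      refine hnp.trans_eq ?_
      ring
    have := (div_pos_iff_of_pos_right hn').mp h3
    linarith
  have hr0 : 0 ≤ r := le_limsup_of_frequently_le
    (Frequently.of_forall fun n => EReal.div_nonneg (hb n) n.cast_nonneg')
  rcases hc.eq_or_lt with rfl | hc
  · rw [EReal.coe_zero, zero_mul]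
    refine EReal.mul_nonpos_iff.mpr (.inl ⟨EReal.coe_nonneg.mpr hd.le, ?_⟩)
    refine EReal.ge_of_forall_gt_iff_ge.mp fun x hx => ?_
    have := key x hx 0 fun h => absurd h (lt_irrefl _)
    rw [← EReal.coe_zero, EReal.coe_le_coe_iff]
    nlinarith
  by_cases hrt : r = ⊤
  · rw [hrt, EReal.coe_mul_top_of_pos hc]
    exact le_top
  lift r to ℝ using ⟨hrt, (EReal.bot_lt_zero.trans_le hr0).ne'⟩ with R
  have hlR : l ≤ ((R * c / d : ℝ) : EReal) := by
    refine EReal.ge_of_forall_gt_iff_ge.mp fun x hx => ?_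
    rw [EReal.coe_le_coe_iff, le_div_iff₀ hd, ← div_le_iff₀ hc]
    refine le_of_forall_gt_imp_ge_of_dense fun y hy => ?_
    rw [div_le_iff₀ hc]
    exact key x hx y fun _ => EReal.coe_lt_coe_iff.mpr hy
  calc (d : EReal) * l ≤ d * ((R * c / d : ℝ) : EReal) :=
        mul_le_mul_of_nonneg_left hlR (EReal.coe_nonneg.mpr hd.le)
    _ = c * R := by
        rw [← EReal.coe_mul, ← EReal.coe_mul, mul_div_cancel₀ _ hd.ne', mul_comm]

end QRT

/-! ### Yield-cost inequality and regularized measures -/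

theorem theorem2 {L : Type*} (dim : L → ℕ+)
    -- free channels, closed under tensor products
    (O : MapFamily dim)
    (hO : ∀ (s t : List L), ∀ M ∈ O s t, IsChannel M)
    (hOtensor : ∀ (s t s' t' : List L), ∀ M ∈ O s t, ∀ M' ∈ O s' t',
      sysTensor M M' ∈ O (s ++ s') (t ++ t'))
    -- free superchannels: any set of superchannels that map free channels to free channels
    (S : SuperFamily dim)
    (hS : ∀ (s t s' t' : List L), ∀ Θ ∈ S s t s' t',
      IsSuperchannel Θ ∧ ∀ M ∈ O s t, Θ M ∈ O s' t')
    -- the given channel and the pure reference channel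
    {s t u v : List L} (E : SysMap dim s t) (hE : IsChannel E)
    (T : SysMap dim u v) (hT : IsChannel T) (hTpure : IsPureChannel T)
    -- distillation at rate `d` with errors `δ n`
    (d : ℝ) (hd : 0 ≤ d)
    (Θd : ∀ n : ℕ, SysMap dim (sysPow s n) (sysPow t n) →ₗ[ℂ]
      SysMap dim (sysPow u ⌊d * n⌋₊) (sysPow v ⌊d * n⌋₊))
    (hΘd : ∀ n : ℕ, 1 ≤ n →
      Θd n ∈ S (sysPow s n) (sysPow t n) (sysPow u ⌊d * n⌋₊) (sysPow v ⌊d * n⌋₊))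
    (δ : ℕ → ℝ)
    (hδ : ∀ n : ℕ, 1 ≤ n → δ n = 1 - chanFidelity (Θd n (mapPow E n)) (mapPow T ⌊d * n⌋₊))
    -- dilution at rate `c` with errors `ε n`
    (c : ℝ) (hc : 0 ≤ c)
    (Θc : ∀ n : ℕ, SysMap dim (sysPow u ⌈c * n⌉₊) (sysPow v ⌈c * n⌉₊) →ₗ[ℂ]
      SysMap dim (sysPow s n) (sysPow t n))
    (hΘc : ∀ n : ℕ, 1 ≤ n →
      Θc n ∈ S (sysPow u ⌈c * n⌉₊) (sysPow v ⌈c * n⌉₊) (sysPow s n) (sysPow t n))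
    (ε : ℕ → ℝ)
    (hε : ∀ n : ℕ, 1 ≤ n → ε n = 1 - chanFidelity (Θc n (mapPow T ⌈c * n⌉₊)) (mapPow E n))
    (herr : liminf (fun n => ε n + δ n) atTop < 1)
    -- dilution from zero copies: the trivial channel must count as free
    (hc0 : c = 0 → mapPow T 0 ∈ O [] []) :
    -- the yield-cost inequality, which is that of the limits whenever they exist
    (d : EReal) * liminf (DminRate O T) atTop ≤ (c : EReal) * limsup (DmaxRate O T) atTop ∧
    -- existence of the regularized max-relative entropy measure
    (Dmax O T < ⊤ → ∃ Lmax : ℝ, Tendsto (DmaxRate O T) atTop (𝓝 (Lmax : EReal))) ∧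
    -- existence of the regularized min-relative entropy measure, for a trivial input system
    (Fintype.card (Idx dim u) = 1 → Dmin O T < ⊤ →
      ∃ Lmin : ℝ, Tendsto (DminRate O T) atTop (𝓝 (Lmin : EReal))) := by
  have hTn (n : ℕ) : IsChannel (mapPow T n) := hT.mapPow n
  have hDmax0 (n : ℕ) : 0 ≤ Dmax O (mapPow T n) := Dmax_nonneg (hO _ _) (hTn n)
  have hDmin0 (n : ℕ) : 0 ≤ Dmin O (mapPow T n) := Dmin_nonneg (hO _ _) (hTpure.mapPow n)
  refine ⟨?_, fun hlt => ?_, fun hcard hlt => ?_⟩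
  · have hrate0 : 0 ≤ limsup (DmaxRate O T) atTop := le_limsup_of_frequently_le
      (Frequently.of_forall fun n => EReal.div_nonneg (hDmax0 n) n.cast_nonneg')
    rcases hd.eq_or_lt with rfl | hd
    · rw [EReal.coe_zero, zero_mul]
      exact mul_nonneg (EReal.coe_nonneg.mpr hc) hrate0
    -- A real `liminf` yields frequent smallness only for a sequence that is cobounded; an upper
    -- bound ensures this.
    have hbdd : ∀ᶠ n in atTop, ε n + δ n ≤ 2 := by
      filter_upwards [eventually_ge_atTop 1] with n hn
      rw [hε n hn, hδ n hn]
      linarith [chanFidelity_nonneg (Θc n (mapPow T ⌈c * n⌉₊)) (mapPow E n),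
        chanFidelity_nonneg (Θd n (mapPow E n)) (mapPow T ⌊d * n⌋₊)]
    obtain ⟨b, hb, hb1⟩ := exists_between herr
    have hfreq : ∃ᶠ n in atTop, ε n + δ n < b :=
      frequently_lt_of_liminf_lt (isBoundedUnder_of_eventually_le hbdd).isCoboundedUnder_ge hb
    -- The fidelities sum to more than `2 - b = 1 + η` with `η = 1 - b`, whence the constant.
    refine mul_liminf_le_mul_limsup (C := -Real.logb 2 ((1 - b) ^ 2 / 4)) hDmax0 hd hc
      (fun h => ?_) ((hfreq.and_eventually (eventually_ge_atTop 1)).mono ?_)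
    · refine Dmax_le (l := 0) (hc0 h) ?_
      rw [Real.rpow_zero, one_smul, sub_self]
      exact fun _ _ _ => Matrix.PosSemidef.zero
    rintro n ⟨hn, hn1⟩
    rw [hε n hn1, hδ n hn1] at hn
    -- The infimum over free channels need not be attained, so the bound is proved for all larger
    -- values.
    refine EReal.le_add_of_forall_gt (.inr (EReal.coe_ne_top _)) (.inr (EReal.coe_ne_bot _))
      fun x hx y hy => ?_
    obtain ⟨l, hl, hlx⟩ := EReal.lt_iff_exists_real_btwn.mp hx
    obtain ⟨M, hM, hMT⟩ := exists_isCP_of_Dmax_lt (hO _ _) hl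
    obtain ⟨hΘ₁, hfree₁⟩ := hS _ _ _ _ _ (hΘc n hn1)
    obtain ⟨hΘ₂, hfree₂⟩ := hS _ _ _ _ _ (hΘd n hn1)
    refine (iInf₂_le _ (hfree₂ _ (hfree₁ M hM))).trans ?_
    refine (chanDmin_le_of_superchannels (η := 1 - b) hΘ₁ hΘ₂ (hTn _) (hE.mapPow n)
      (hTpure.mapPow _) (by linarith) (by linarith) hMT).trans ?_
    rw [sub_eq_add_neg, EReal.coe_add]
    exact add_le_add hlx.le hy.le
  · exact tendsto_div_of_subadditive hDmax0 (fun m n => by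
      rw [Dmax_congr (sysPow_add u m n) (sysPow_add v m n) (mapPow_add T m n)]
      exact Dmax_sysTensor_le hO hOtensor (hTn m) (hTn n))
      ((Dmax_congr (List.append_nil u).symm (List.append_nil v).symm (mapPow_one T)).symm.trans_lt hlt)
  · have hsub : Subsingleton (Idx dim u) := Fintype.card_le_one_iff_subsingleton.mp hcard.le
    have hsubn (n : ℕ) := subsingleton_idx_sysPow (dim := dim) (s := u) n
    exact tendsto_div_of_subadditive hDmin0 (fun m n => by
      rw [Dmin_congr (sysPow_add u m n) (sysPow_add v m n) (mapPow_add T m n)]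
      have := hsubn m
      have := hsubn n
      exact Dmin_sysTensor_le hO hOtensor (hTn m) (hTpure.mapPow m) (hTn n) (hTpure.mapPow n))
      ((Dmin_congr (List.append_nil u).symm (List.append_nil v).symm (mapPow_one T)).symm.trans_lt hlt)
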